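/- Let $d\ge 2$ and let $\mathbb T=(\mathbb R/\mathbb Z)^d$ carry Lebesgue measure. For measurable $V\subseteq\mathbb T$ let $\mathcal P(V)=\sup\{\int_V \operatorname{div}\phi\,dx:\ \phi\in C^1(\mathbb T,\mathbb R^d),\ |\phi|\le 1\}$ be its perimeter. For $a>0$ let $K_a$ be the set of measurable $v:\mathbb T\to\{\pm1\}$ with $\mathcal P(\{v=1\})\le a$, and for $\varepsilon>0$ let $\mathcal V(K_a,\varepsilon)$ be the set of $w\in L^1(\mathbb T)$ with $\int_{\mathbb T}|w-v|\,dx\le\varepsilon$ for some $v\in K_a$. For an integer $m\ge 0$ let $\mathbb T_m\subset\mathbb T$ be the set of the $2^{dm}$ points with coordinates in $2^{-m}\mathbb Z/\mathbb Z$ (sites). For $x\in\mathbb T$ put $B_m(x)=x+[-2^{-m-1},2^{-m-1})^d$; the boxes $B_m(x)$, $x\in\mathbb T_m$, partition $\mathbb T$. Let $\mathcal F_m$ be the finite algebra of sets which they generate. Two distinct sites of $\mathbb T_m$ (and their boxes) are $*$-neighbours if their coordinates differ, modulo $1$, by $0$ or $\pm 2^{-m}$. A $*$-connected chain is a finite sequence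 of boxes in which consecutive ones are $*$-neighbours. **Theorem.** There is a constant $c_1=c_1(d)>0$ such that for every sequence $(\rho_k)$ in $[0,1]$ with $\rho_k\to0$ and every $\delta>0$ there is $k_0=k_0(\delta)\ge1$ (depending only on $d$, $(\rho_k)$ and $\delta$) with the following property. Let $a>0$, $n\in\mathbb N$, $N=2^n$, and let $u_1,\dots,u_n$ be random $\{\pm1,0\}$-valued functions on $\mathbb T$, defined on a common probability space $(\Omega_N,\mathcal A_N,\mathbb P_N)$, such that the realizations of $u_k$ are $\mathcal F_{n-k}$-measurable. Assume that for every $k=1,\dots,n$: **A.** The random set $\{x\in\mathbb T_{n-k}: u_k(x)=0\}$ is stochastically dominated by the set of open sites of Bernoulli site percolation of density $\rho_k$ on $\mathbb T_{n-k}$; that is, for every increasing family $U$ of subsets of $\mathbb T_{n-k}$, the probability that the zero set belongs to $U$ is at most the probability that the set of open sites belongs to $U$. **B.** Almost surely, whenever $x,y\in\mathbb T_{n-k}$ satisfy $u_k(x)u_k(y)=-1$, then for every finer scale $1\le k'\le k$ every $*$-connected chain of boxes $B_{n-k'}(z)$, $z\in\mathbb T_{n-k'}$, joining $B_{n-k}(x)$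 to $B_{n-k}(y)$ (the first box of the chain has its centre in $B_{n-k}(x)$ and the last one has its centre in $B_{n-k}(y)$) contains at least one box $B_{n-k'}(z)$ with $u_{k'}(z)=0$. Then for all $k$ with $k_0\le k\le n$, $$\mathbb P_N\big(u_k\notin\mathcal V(K_a,2\delta)\big)\ \le\ \exp\Big(-c_1N^{d-1}\min\Big\{\delta\,2^{\,n-dk},\ \frac{a}{2^{(d-1)k_0}},\ \frac{\delta\,2^{\,n-dk_0}}{n^d}\Big\}\Big).$$ -/

import Mathlib

open MeasureTheory ProbabilityTheory Filter Topology
open scoped ENNReal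

noncomputable section

namespace PhaseLabels

/-! ### Functions of bounded variation on the unit torus -/

/-- `φ` is a `C¹` vector field on the unit torus `(ℝ/ℤ)^d` with Euclidean norm at most one. -/
def IsTestField {d : ℕ} (φ : UnitAddTorus (Fin d) → EuclideanSpace ℝ (Fin d)) : Prop :=
  ContDiff ℝ 1 (fun x : Fin d → ℝ => φ (fun i => (x i : UnitAddCircle))) ∧ ∀ p, ‖φ p‖ ≤ 1

/-- The divergence of a vector field on the unit torus. -/
def divergence {d : ℕ} (φ : UnitAddTorus (Fin d) → EuclideanSpace ℝ (Fin d))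
    (p : UnitAddTorus (Fin d)) : ℝ :=
  ∑ i : Fin d, deriv (fun t : ℝ => φ (p + Pi.single i (t : UnitAddCircle)) i) 0

/-- The perimeter of a (measurable) subset `V` of the unit torus,
`sup {∫_V div φ : φ ∈ C¹, |φ| ≤ 1}`.  The supremum is nonnegative because of `φ = 0`, so taking
positive parts of the integrals does not change it. -/
def perimeter {d : ℕ} (V : Set (UnitAddTorus (Fin d))) : ℝ≥0∞ :=
  ⨆ (φ : UnitAddTorus (Fin d) → EuclideanSpace ℝ (Fin d)) (_ : IsTestField φ),
    ENNReal.ofReal (∫ p in V, divergence φ p)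

/-- The `±1`-valued functions of bounded variation on the unit torus. -/
def BV (d : ℕ) : Set (UnitAddTorus (Fin d) → ℝ) :=
  {v | Measurable v ∧ (∀ p, v p = 1 ∨ v p = -1) ∧ perimeter {p | v p = 1} < ∞}

/-- The perimeter ball `K_a`. -/
def perimeterBall (d : ℕ) (a : ℝ) : Set (UnitAddTorus (Fin d) → ℝ) :=
  {v | v ∈ BV d ∧ perimeter {p | v p = 1} ≤ ENNReal.ofReal a}

/-- The (closed) `ε`-neighbourhood `𝒱(K, ε)` of a set `K` of functions, in `L¹` of the torus. -/
def nbhd {d : ℕ} (K : Set (UnitAddTorus (Fin d) → ℝ)) (ε : ℝ) :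
    Set (UnitAddTorus (Fin d) → ℝ) :=
  {w | Integrable w ∧ ∃ v ∈ K, ∫ p, |w p - v p| ≤ ε}

/-! ### Mesoscopic boxes -/

/-- The discrete torus with `2^m` sites in each direction. -/
abbrev Lattice (d m : ℕ) : Type := Fin d → ZMod (2 ^ m)

/-- The embedding `x ↦ x / 2^m` of the discrete torus into the unit torus. -/
def site {d m : ℕ} (x : Lattice d m) : UnitAddTorus (Fin d) :=
  fun i => ZMod.toAddCircle (x i)

/-- The box `p + [-2^{-(m+1)}, 2^{-(m+1)})^d` of side length `2^{-m}` centred at `p`. -/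
def box {d : ℕ} (m : ℕ) (p : UnitAddTorus (Fin d)) : Set (UnitAddTorus (Fin d)) :=
  {q | ∀ i, ∃ t : ℝ, t ∈ Set.Ico (-(1 / 2 ^ (m + 1))) (1 / 2 ^ (m + 1)) ∧
    q i = p i + (t : UnitAddCircle)}

/-- The finite algebra generated by the boxes of side length `2^{-m}` centred at the sites. -/
@[reducible] def boxAlgebra (d m : ℕ) : MeasurableSpace (UnitAddTorus (Fin d)) :=
  MeasurableSpace.generateFrom (Set.range fun x : Lattice d m => box m (site x))

/-- `w` is a `{±1, 0}`-valued function which is measurable with respect to the algebra of boxes of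
side length `2^{-m}`. -/
def IsPhaseLabel {d : ℕ} (m : ℕ) (w : UnitAddTorus (Fin d) → ℝ) : Prop :=
  (∀ p, w p = 1 ∨ w p = -1 ∨ w p = 0) ∧ Measurable[boxAlgebra d m] w

/-- The set of sites whose box carries the label zero. -/
def zeroSet {d : ℕ} (m : ℕ) (w : UnitAddTorus (Fin d) → ℝ) : Set (Lattice d m) :=
  {x | w (site x) = 0}

/-- Two distinct sites are `*`-neighbours if they differ by at most one (periodically) in each
coordinate. -/
def starGraph (d m : ℕ) : SimpleGraph (Lattice d m) where
  Adj x y := x ≠ y ∧ ∀ i, y i = x i ∨ y i = x i + 1 ∨ x i = y i + 1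
  symm := ⟨fun _ _ h => ⟨h.1.symm, fun i => by
    rcases h.2 i with h | h | h
    · exact Or.inl h.symm
    · exact Or.inr (Or.inr h)
    · exact Or.inr (Or.inl h)⟩⟩
  loopless := ⟨fun _ h => h.1 rfl⟩

/-! ### The two assumptions -/

/-- `μ` is stochastically dominated by `ν`. -/
def StochDominatedBy {α : Type*} [Preorder α] [MeasurableSpace α] (μ ν : Measure α) : Prop :=
  ∀ U : Set α, IsUpperSet U → MeasurableSet U → μ U ≤ ν U

/-- The law of the random set of zero blocks of the random label `w`, at side length `2^{-m}`, is
stochastically dominated by Bernoulli site percolation of density `r`. -/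
def AssumptionA {d : ℕ} {Ω : Type*} [MeasurableSpace Ω] (P : Measure Ω) (m : ℕ)
    (r : unitInterval) (w : Ω → UnitAddTorus (Fin d) → ℝ) : Prop :=
  StochDominatedBy (P.map fun ω => zeroSet m (w ω))
    (setBernoulli (Set.univ : Set (Lattice d m)) r)

/-- For one realization `u` of the labels on the scales `1, …, n` (the blocks of scale `k` have
side length `2^{-(n-k)}`): if two `k`-blocks have opposite signs, then, for every scale
`1 ≤ k' ≤ k`, every `*`-connected chain of `k'`-blocks that starts at a `k'`-block centred in the
first `k`-block and ends at a `k'`-block centred in the second one contains a `k'`-block with label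
zero. -/
def AssumptionB {d : ℕ} (n : ℕ) (u : ℕ → UnitAddTorus (Fin d) → ℝ) (k : ℕ) : Prop :=
  ∀ x y : Lattice d (n - k), u k (site x) * u k (site y) = -1 →
    ∀ k' : ℕ, 1 ≤ k' → k' ≤ k → ∀ x' y' : Lattice d (n - k'),
      site x' ∈ box (n - k) (site x) → site y' ∈ box (n - k) (site y) →
        ∀ chain : (starGraph d (n - k')).Walk x' y',
          ∃ z ∈ chain.support, u k' (site z) = 0

end PhaseLabels

end

/-! Fix one scale `κ`, depending only on `d`, the densities and `δ`, from which on the zeros are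
sparse, and read the labels at a scale `k > κ` on the `κ`-lattice. By assumption B no `κ`-chain
avoiding zeros joins two `k`-blocks of opposite sign. So the signs at scale `k` extend to a sign
field `s` on the `κ`-lattice all of whose sign changes occur on edges touching a zero
(`exists_sign_field`).

Regard `s` as `ZMod 2`-valued. Its coboundary splits into pieces, one for each `*`-cluster `S` of
zeros. Each piece is a closed cochain, because the corners of a unit square are pairwise equal or
`*`-neighbours. If `S` has fewer sites than the side of the lattice, it cannot wrap around the
torus, and its piece is the coboundary of a function supported in a product of projections, hence on
at most `|S|^d` sites (`exists_potential`). Subtracting these functions for all clusters with at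
most `n` sites turns `s` into a field `v`. It differs from `s` on at most the sum of `|S|^d` over
the small clusters, and it jumps only next to the large ones, which bounds its perimeter by their
total size (`exists_filling`, `perimeter_cells_le`).

Hence `u k` can be far from `K_a` only if one of three events occurs: many zeros at scale `k`, large
clusters of big total size at scale `κ`, or small clusters of big total volume at scale `κ`. Each is
a statement about a sum `∑ f S` over clusters. The only consequence of assumption A that is needed
is that a given set `S` consists of zeros with probability at most `r ^ |S|`; together with a count
of connected sets it bounds the exponential moment of such a sum (`expect_prod_clusters_le`,
`sum_animals_le`, `cluster_tail_bound`).

The cutoff `n = log₂ N` serves both sides: a cluster with more than `n` sites has a weight that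
beats the number of sites, while below the cutoff `|S|^d / n^d ≤ 1` has a harmless exponential
moment, at the price of `n^d` in the rate. Each event gets the prefactor `1/3`, so the three bounds
add up to a pure exponential. -/

noncomputable section

namespace PhaseLabels

/-! ### Clusters of a vertex set in a finite graph -/

section Clusters

open scoped Classical

variable {V : Type*} [Fintype V] (G : SimpleGraph V)

/-- The graph `G` with only those edges kept that have both endpoints in `A`. -/
def openGraph (A : Finset V) : SimpleGraph V where
  Adj x y := G.Adj x y ∧ x ∈ A ∧ y ∈ A
  symm := ⟨fun _ _ h => ⟨h.1.symm, h.2.2, h.2.1⟩⟩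
  loopless := ⟨fun _ h => h.1.ne rfl⟩

/-- The vertices that are reachable from `x` inside `A`. -/
def cluster (A : Finset V) (x : V) : Finset V :=
  Finset.univ.filter fun y => (openGraph G A).Reachable x y

/-- The clusters of `A`. -/
def clusters (A : Finset V) : Finset (Finset V) := A.image (cluster G A)

/-- The nonempty connected vertex sets. -/
def animals : Finset (Finset V) :=
  Finset.univ.filter fun S => S.Nonempty ∧ ∀ x ∈ S, cluster G S x = S

variable {G}

lemma mem_cluster {A : Finset V} {x y : V} :
    y ∈ cluster G A x ↔ (openGraph G A).Reachable x y := by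
  simp [cluster]

lemma self_mem_cluster (A : Finset V) (x : V) : x ∈ cluster G A x :=
  mem_cluster.2 (SimpleGraph.Reachable.refl x)

lemma cluster_eq_of_mem {A : Finset V} {x y : V} (h : y ∈ cluster G A x) :
    cluster G A y = cluster G A x := by
  ext z
  rw [mem_cluster] at *
  rw [mem_cluster]
  exact ⟨fun h' => h.trans h', fun h' => h.symm.trans h'⟩

lemma cluster_subset_of_closed {A S : Finset V} {x : V} (hx : x ∈ S)
    (h : ∀ y ∈ S, ∀ z ∈ A, G.Adj y z → z ∈ S) : cluster G A x ⊆ S := by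
  intro y hy
  rw [mem_cluster, SimpleGraph.reachable_iff_reflTransGen] at hy
  induction hy with
  | refl => exact hx
  | tail _ hbc ih => exact h _ ih _ hbc.2.2 hbc.1

lemma cluster_subset {A : Finset V} {x : V} (hx : x ∈ A) : cluster G A x ⊆ A :=
  cluster_subset_of_closed hx fun _ _ _ hz _ => hz

lemma cluster_mono {A B : Finset V} (h : A ⊆ B) (x : V) : cluster G A x ⊆ cluster G B x := by
  intro y hy
  rw [mem_cluster] at *
  have hle : openGraph G A ≤ openGraph G B := fun a b (hab : G.Adj a b ∧ a ∈ A ∧ b ∈ A) =>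
    ⟨hab.1, h hab.2.1, h hab.2.2⟩
  exact hy.mono hle

lemma mem_cluster_of_adj {A : Finset V} {x y z : V} (hy : y ∈ cluster G A x) (hyA : y ∈ A)
    (hz : z ∈ A) (h : G.Adj y z) : z ∈ cluster G A x := by
  rw [mem_cluster] at *
  exact hy.trans (SimpleGraph.Adj.reachable (show (openGraph G A).Adj y z from ⟨h, hyA, hz⟩))

lemma cluster_cluster (A : Finset V) (x : V) :
    cluster G (cluster G A x) x = cluster G A x := by
  refine Finset.Subset.antisymm (cluster_subset (self_mem_cluster A x)) ?_
  intro y hy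
  have hy' := hy
  rw [mem_cluster, SimpleGraph.reachable_iff_reflTransGen] at hy
  induction hy with
  | refl => exact self_mem_cluster _ x
  | @tail b c hab hbc ih =>
    have hb : b ∈ cluster G A x :=
      mem_cluster.2 ((SimpleGraph.reachable_iff_reflTransGen _ _).2 hab)
    exact mem_cluster_of_adj (ih hb) hb hy' hbc.1

lemma exists_eq_cluster {A S : Finset V} (h : S ∈ clusters G A) : ∃ x ∈ A, cluster G A x = S := by
  simpa [clusters] using h

lemma cluster_mem_clusters {A : Finset V} {x : V} (hx : x ∈ A) : cluster G A x ∈ clusters G A :=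
  Finset.mem_image_of_mem _ hx

lemma cluster_eq_of_mem_clusters {A S : Finset V} (h : S ∈ clusters G A) {x : V} (hx : x ∈ S) :
    cluster G A x = S := by
  obtain ⟨y, -, rfl⟩ := exists_eq_cluster h
  exact cluster_eq_of_mem hx

lemma subset_of_mem_clusters {A S : Finset V} (h : S ∈ clusters G A) : S ⊆ A := by
  obtain ⟨y, hy, rfl⟩ := exists_eq_cluster h
  exact cluster_subset hy

lemma mem_of_adj_of_mem_clusters {A S : Finset V} (h : S ∈ clusters G A) {x y : V} (hx : x ∈ S)
    (hy : y ∈ A) (hxy : G.Adj x y) : y ∈ S := by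
  rw [← cluster_eq_of_mem_clusters h hx]
  exact mem_cluster_of_adj (self_mem_cluster A x) (subset_of_mem_clusters h hx) hy hxy

lemma mem_animals_of_mem_clusters {A S : Finset V} (h : S ∈ clusters G A) : S ∈ animals G := by
  simp only [animals, Finset.mem_filter, Finset.mem_univ, true_and]
  refine ⟨?_, fun x hx => ?_⟩
  · obtain ⟨y, hy, rfl⟩ := exists_eq_cluster h
    exact ⟨y, self_mem_cluster A y⟩
  · rw [← cluster_eq_of_mem_clusters h hx]
    exact cluster_cluster A x

lemma pairwiseDisjoint_clusters (A : Finset V) :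
    (clusters G A : Set (Finset V)).PairwiseDisjoint id := by
  intro S hS T hT hST
  refine Finset.disjoint_left.2 fun x hxS hxT => hST ?_
  rw [← cluster_eq_of_mem_clusters hS hxS, ← cluster_eq_of_mem_clusters hT hxT]

lemma sum_card_clusters (A : Finset V) : ∑ S ∈ clusters G A, S.card = A.card := by
  rw [← Finset.card_biUnion (t := fun S => S) fun S hS T hT hST =>
    pairwiseDisjoint_clusters A hS hT hST]
  congr 1
  ext x
  simp only [Finset.mem_biUnion]
  exact ⟨fun ⟨S, hS, hx⟩ => subset_of_mem_clusters hS hx,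
    fun hx => ⟨_, cluster_mem_clusters hx, self_mem_cluster A x⟩⟩

/-! ### Counting connected sets -/

/-- The closed neighbourhood of a vertex set. -/
def closedNbhd (G : SimpleGraph V) (S : Finset V) : Finset V :=
  S.biUnion fun x => Finset.univ.filter fun y => y = x ∨ G.Adj x y

lemma subset_closedNbhd (S : Finset V) : S ⊆ closedNbhd G S := fun x hx => by
  simp only [closedNbhd, Finset.mem_biUnion, Finset.mem_filter, Finset.mem_univ, true_and]
  exact ⟨x, hx, Or.inl rfl⟩

lemma card_closedNbhd_le {D : ℕ}
    (h : ∀ x, ∃ F : Finset V, F.card ≤ D ∧ ∀ y, y = x ∨ G.Adj x y → y ∈ F) (S : Finset V) :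
    (closedNbhd G S).card ≤ D * S.card := by
  refine Finset.card_biUnion_le.trans ?_
  rw [mul_comm, ← smul_eq_mul]
  refine Finset.sum_le_card_nsmul _ _ _ fun x _ => ?_
  obtain ⟨F, hF, hFx⟩ := h x
  exact (Finset.card_le_card fun y hy => hFx y (Finset.mem_filter.1 hy).2).trans hF

/-- A connected set that is open while its outer boundary is closed is a full cluster. This makes
the events in the counting argument below disjoint. -/
lemma cluster_eq_of_inter_closedNbhd {A S : Finset V} (hS : S ∈ animals G) {x : V} (hx : x ∈ S)
    (h : A ∩ closedNbhd G S = S) : cluster G A x = S := by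
  have hS' : cluster G S x = S := by
    simp only [animals, Finset.mem_filter] at hS
    exact hS.2.2 x hx
  refine Finset.Subset.antisymm (cluster_subset_of_closed hx fun y hy z hz hyz => ?_) ?_
  · rw [← h]
    simp only [closedNbhd, Finset.mem_inter, Finset.mem_biUnion, Finset.mem_filter,
      Finset.mem_univ, true_and]
    exact ⟨hz, y, hy, Or.inr hyz⟩
  · have hSA : S ⊆ A := by
      rw [← h]
      exact Finset.inter_subset_left
    calc S = cluster G S x := hS'.symm
      _ ⊆ cluster G A x := cluster_mono hSA x

/-- A weighted count of the connected sets through a given vertex. -/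
lemma sum_animals_through_le_one {D : ℕ}
    (hD : ∀ S : Finset V, (closedNbhd G S).card ≤ D * S.card) (x : V) :
    ∑ S ∈ (animals G).filter (x ∈ ·), ((1 : ℝ) / 2) ^ (D * S.card) ≤ 1 := by
  set F : Finset (Finset V) := (animals G).filter (x ∈ ·) with hF
  let E : Finset V → Finset (Finset V) := fun S =>
    Finset.univ.filter fun A => A ∩ closedNbhd G S = S
  have hdisj : ∀ S ∈ F, ∀ T ∈ F, S ≠ T → Disjoint (E S) (E T) := by
    intro S hS T hT hST
    refine Finset.disjoint_left.2 fun A hA hA' => hST ?_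
    simp only [hF, E, Finset.mem_filter, Finset.mem_univ, true_and] at hS hT hA hA'
    rw [← cluster_eq_of_inter_closedNbhd hS.1 hS.2 hA,
      cluster_eq_of_inter_closedNbhd hT.1 hT.2 hA']
  have hcard : ∀ S : Finset V, 2 ^ (Fintype.card V - (closedNbhd G S).card) ≤ (E S).card := by
    intro S
    rw [← Finset.card_compl, ← Finset.card_powerset]
    refine Finset.card_le_card_of_injOn (fun B => S ∪ B) ?_ ?_
    · intro B hB
      have hB' : B ⊆ (closedNbhd G S)ᶜ := Finset.mem_powerset.1 hB
      have hBd : B ∩ closedNbhd G S = ∅ := by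
        rw [← Finset.disjoint_iff_inter_eq_empty]
        exact Finset.disjoint_of_subset_left hB' disjoint_compl_left
      simp only [E, Finset.coe_filter, Finset.mem_univ, true_and, Set.mem_ofPred_eq]
      rw [Finset.union_inter_distrib_right, hBd, Finset.union_empty]
      exact Finset.inter_eq_left.2 (subset_closedNbhd S)
    · intro B hB B' hB' h
      have aux : ∀ C : Finset V, C ⊆ (closedNbhd G S)ᶜ → (S ∪ C) \ S = C := by
        intro C hC
        rw [Finset.union_sdiff_left]
        refine Finset.sdiff_eq_self_of_disjoint ?_
        exact Finset.disjoint_of_subset_left hC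
          (Finset.disjoint_of_subset_right (subset_closedNbhd S) disjoint_compl_left)
      have h1 := aux B (Finset.mem_powerset.1 hB)
      have h2 := aux B' (Finset.mem_powerset.1 hB')
      simp only at h
      rw [← h1, ← h2, h]
  have htot : ∑ S ∈ F, (2 : ℝ) ^ (Fintype.card V - (closedNbhd G S).card)
      ≤ 2 ^ Fintype.card V := by
    have : ∑ S ∈ F, 2 ^ (Fintype.card V - (closedNbhd G S).card) ≤ 2 ^ Fintype.card V := by
      calc _ ≤ ∑ S ∈ F, (E S).card := Finset.sum_le_sum fun S _ => hcard S
        _ = (F.biUnion E).card := (Finset.card_biUnion hdisj).symm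
        _ ≤ (Finset.univ : Finset (Finset V)).card := Finset.card_le_card (Finset.subset_univ _)
        _ = 2 ^ Fintype.card V := by simp
    exact_mod_cast this
  have hpos : (0 : ℝ) < 2 ^ Fintype.card V := by positivity
  refine le_of_mul_le_mul_left ?_ hpos
  rw [mul_one, Finset.mul_sum]
  refine le_trans (Finset.sum_le_sum fun S _ => ?_) htot
  have hN : (closedNbhd G S).card ≤ Fintype.card V := Finset.card_le_univ _
  calc (2 : ℝ) ^ Fintype.card V * (1 / 2) ^ (D * S.card)
      ≤ 2 ^ Fintype.card V * (1 / 2) ^ (closedNbhd G S).card := by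
        refine mul_le_mul_of_nonneg_left ?_ hpos.le
        exact pow_le_pow_of_le_one (by norm_num) (by norm_num) (hD S)
    _ = 2 ^ (Fintype.card V - (closedNbhd G S).card) := by
        rw [pow_sub₀ _ two_ne_zero hN, one_div, inv_pow]

lemma sum_animals_le {D : ℕ} (hD : ∀ S : Finset V, (closedNbhd G S).card ≤ D * S.card)
    {g : Finset V → ℝ} (hg : ∀ S, 0 ≤ g S) {M : ℝ}
    (hM : ∀ S : Finset V, S.Nonempty → g S * 2 ^ (D * S.card) ≤ M) :
    ∑ S ∈ animals G, g S ≤ Fintype.card V * M := by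
  have hne : ∀ S ∈ animals G, S.Nonempty := fun S hS => by
    simp only [animals, Finset.mem_filter] at hS
    exact hS.2.1
  have h1 : ∑ S ∈ animals G, g S ≤ ∑ x : V, ∑ S ∈ (animals G).filter (x ∈ ·), g S := by
    simp_rw [Finset.sum_filter]
    rw [Finset.sum_comm]
    refine Finset.sum_le_sum fun S hS => ?_
    obtain ⟨x, hx⟩ := hne S hS
    calc g S = if x ∈ S then g S else 0 := by rw [if_pos hx]
      _ ≤ _ := Finset.single_le_sum (f := fun x => if x ∈ S then g S else 0)
        (fun y _ => by split_ifs <;> simp [hg]) (Finset.mem_univ x)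
  refine h1.trans ?_
  rw [← nsmul_eq_mul, ← Finset.card_univ]
  refine Finset.sum_le_card_nsmul _ _ _ fun x _ => ?_
  have hM0 : 0 ≤ M := le_trans (mul_nonneg (hg {x}) (by positivity)) (hM {x} (by simp))
  calc ∑ S ∈ (animals G).filter (x ∈ ·), g S
      ≤ ∑ S ∈ (animals G).filter (x ∈ ·), M * (1 / 2) ^ (D * S.card) := by
        refine Finset.sum_le_sum fun S hS => ?_
        have := hM S (hne S (Finset.mem_filter.1 hS).1)
        rw [one_div, inv_pow, ← div_eq_mul_inv, le_div_iff₀ (by positivity)]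
        exact this
    _ = M * ∑ S ∈ (animals G).filter (x ∈ ·), ((1 : ℝ) / 2) ^ (D * S.card) := by
        rw [Finset.mul_sum]
    _ ≤ M := mul_le_of_le_one_right hM0 (sum_animals_through_le_one hD x)

/-! ### Exponential moments of cluster functionals -/

variable {p : Finset V → ℝ} {r : ℝ}

/-- Expanding the product gives a sum over families `C` of clusters. Distinct clusters are disjoint,
so the probability that all members of `C` are clusters is at most the product of the `r ^ |S|`. The
sum then factorizes again, now over all connected sets. -/
lemma expect_prod_clusters_le (hp : ∀ A, 0 ≤ p A)
    (hr : ∀ S : Finset V, ∑ A, (if S ⊆ A then p A else 0) ≤ r ^ S.card) (hr0 : 0 ≤ r)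
    {w : Finset V → ℝ} (hw : ∀ S, 0 ≤ w S) :
    ∑ A, p A * ∏ S ∈ clusters G A, (1 + w S) ≤
      Real.exp (∑ S ∈ animals G, w S * r ^ S.card) := by
  have h1 : ∀ A : Finset V, p A * ∏ S ∈ clusters G A, (1 + w S) =
      ∑ C ∈ (animals G).powerset, (∏ S ∈ C, w S) * if C ⊆ clusters G A then p A else 0 := by
    intro A
    rw [Finset.prod_one_add, Finset.mul_sum]
    simp_rw [mul_ite, mul_zero]
    rw [← Finset.sum_filter]
    refine Finset.sum_congr ?_ fun C _ => mul_comm _ _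
    ext C
    simp only [Finset.mem_powerset, Finset.mem_filter]
    exact ⟨fun h => ⟨fun S hS => mem_animals_of_mem_clusters (h hS), h⟩, fun h => h.2⟩
  simp_rw [h1]
  rw [Finset.sum_comm]
  calc _ ≤ ∑ C ∈ (animals G).powerset, ∏ S ∈ C, (w S * r ^ S.card) := by
        refine Finset.sum_le_sum fun C _ => ?_
        rw [← Finset.mul_sum, Finset.prod_mul_distrib]
        refine mul_le_mul_of_nonneg_left ?_ (Finset.prod_nonneg fun S _ => hw S)
        by_cases hC : ∃ A, C ⊆ clusters G A
        · obtain ⟨A₀, hA₀⟩ := hC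
          rw [Finset.prod_pow_eq_pow_sum, ← Finset.card_biUnion (t := fun S => S)
            fun S hS T hT hST => pairwiseDisjoint_clusters A₀ (hA₀ hS) (hA₀ hT) hST]
          refine le_trans (Finset.sum_le_sum fun A _ => ?_) (hr _)
          by_cases hA : C ⊆ clusters G A
          · rw [if_pos hA, if_pos]
            exact Finset.biUnion_subset.2 fun S hS => subset_of_mem_clusters (hA hS)
          · rw [if_neg hA]
            split_ifs
            exacts [hp A, le_rfl]
        -- A family that never consists of clusters, for instance one with overlapping members,
        -- contributes zero.
        · push Not at hC
          rw [Finset.sum_eq_zero fun A _ => if_neg (hC A)]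
          exact Finset.prod_nonneg fun S _ => by positivity
    _ = ∏ S ∈ animals G, (1 + w S * r ^ S.card) := (Finset.prod_one_add _).symm
    _ ≤ ∏ S ∈ animals G, Real.exp (w S * r ^ S.card) := by
        refine Finset.prod_le_prod (fun S _ => ?_) fun S _ => ?_
        · have := hw S
          positivity
        · rw [add_comm]
          exact Real.add_one_le_exp _
    _ = _ := (Real.exp_sum _ _).symm

/-- An exponential tail bound, with a small prefactor, for a functional of the clusters. -/
lemma cluster_tail_bound (hp : ∀ A, 0 ≤ p A) (hp1 : ∑ A, p A = 1)
    (hr : ∀ S : Finset V, ∑ A, (if S ⊆ A then p A else 0) ≤ r ^ S.card) (hr0 : 0 ≤ r)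
    {f : Finset V → ℝ} (hf : ∀ S, 0 ≤ f S) {τ : ℝ} (hτ : 0 < τ)
    (h : ∑ S ∈ animals G, (Real.exp (f S) - 1) * r ^ S.card ≤ τ / 9) :
    ∑ A, (if τ ≤ ∑ S ∈ clusters G A, f S then p A else 0) ≤ 1 / 3 * Real.exp (-(τ / 4)) := by
  set Q : ℝ := ∑ A, (if τ ≤ ∑ S ∈ clusters G A, f S then p A else 0) with hQ
  have hQ0 : 0 ≤ Q := Finset.sum_nonneg fun A _ => by
    split_ifs
    exacts [hp A, le_rfl]
  have hexp := expect_prod_clusters_le (G := G) hp hr hr0 (w := fun S => Real.exp (f S) - 1)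
    fun S => by
      have := Real.add_one_le_exp (f S)
      linarith [hf S]
  simp only [add_sub_cancel] at hexp
  simp_rw [← Real.exp_sum] at hexp
  have hX0 : ∀ A : Finset V, 0 ≤ ∑ S ∈ clusters G A, f S := fun A =>
    Finset.sum_nonneg fun S _ => hf S
  -- Markov's inequality for `exp X - 1` instead of `exp X`: the subtraction of `1` keeps the bound
  -- below `1/9` even when `τ` is small.
  have h1 : Q * (Real.exp τ - 1) ≤ Real.exp (τ / 9) - 1 := by
    calc Q * (Real.exp τ - 1)
        ≤ ∑ A, p A * (Real.exp (∑ S ∈ clusters G A, f S) - 1) := by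
          rw [hQ, Finset.sum_mul]
          refine Finset.sum_le_sum fun A _ => ?_
          split_ifs with hA
          · refine mul_le_mul_of_nonneg_left ?_ (hp A)
            have := Real.exp_le_exp.2 hA
            linarith
          · rw [zero_mul]
            refine mul_nonneg (hp A) ?_
            have := Real.one_le_exp (hX0 A)
            linarith
      _ = ∑ A, p A * Real.exp (∑ S ∈ clusters G A, f S) - 1 := by
          simp_rw [mul_sub, mul_one]
          rw [Finset.sum_sub_distrib, hp1]
      _ ≤ Real.exp (τ / 9) - 1 := by
          have := hexp.trans (Real.exp_le_exp.2 h)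
          linarith
  set y : ℝ := Real.exp (τ / 9) with hy
  have hy1 : 1 < y := Real.one_lt_exp_iff.2 (by positivity)
  have hy9 : Real.exp τ = y ^ 9 := by
    rw [hy, ← Real.exp_nat_mul]
    congr 1
    push_cast
    ring
  rw [hy9] at h1
  have hden : 0 < y ^ 9 - 1 := by
    have := one_lt_pow₀ hy1 (n := 9) (by norm_num)
    linarith
  have hQa : Q ≤ 1 / 9 := by
    have hb := one_add_mul_le_pow (a := y - 1) (by linarith) 9
    rw [add_sub_cancel] at hb
    push_cast at hb
    refine le_of_mul_le_mul_right ?_ hden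
    linarith
  have hQb : Q * y ^ 8 ≤ 1 := by
    have hy8 : (1 : ℝ) ≤ y ^ 8 := one_le_pow₀ hy1.le
    refine le_of_mul_le_mul_right ?_ hden
    have := mul_le_mul_of_nonneg_right h1 (zero_le_one.trans hy8)
    nlinarith
  have hexp4 : (1 : ℝ) ≤ Real.exp (-(τ / 4)) ^ 2 * y ^ 8 := by
    rw [hy, ← Real.exp_nat_mul, ← Real.exp_nat_mul, ← Real.exp_add]
    refine Real.one_le_exp ?_
    push_cast
    linarith
  -- The geometric mean of `Q ≤ 1/9` and `Q ≤ y⁻⁸` yields both the prefactor `1/3` and the decay.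
  refine le_of_sq_le_sq ?_ (by positivity)
  have hy8 : 0 < y ^ 8 := by positivity
  refine le_of_mul_le_mul_right ?_ hy8
  nlinarith

end Clusters

/-! ### Closed cochains on the discrete torus -/

section Cochains

/-- A closed one-cochain on the discrete torus which vanishes on all edges that do not touch `S` is
the coboundary of a function supported in the product of the coordinate projections of `S`,
provided that none of these projections is surjective. -/
lemma exists_potential {d ℓ : ℕ} [NeZero ℓ] {M : Type*} [AddCommGroup M] (hd : 2 ≤ d)
    {S : Finset (Fin d → ZMod ℓ)} {α : Fin d → (Fin d → ZMod ℓ) → M}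
    (hclosed : ∀ i j x, α i x + α j (x + Pi.single i 1) = α j x + α i (x + Pi.single j 1))
    (hsupp : ∀ i x, x ∉ S → x + Pi.single i 1 ∉ S → α i x = 0)
    {c : Fin d → ZMod ℓ} (hc : ∀ j, ∀ y ∈ S, y j ≠ c j) :
    ∃ g : (Fin d → ZMod ℓ) → M, (∀ i x, g (x + Pi.single i 1) - g x = α i x) ∧
      ∀ x, g x ≠ 0 → ∀ j, ∃ y ∈ S, y j = x j := by
  obtain ⟨i₀, j₀, hij⟩ : ∃ i₀ j₀ : Fin d, i₀ ≠ j₀ :=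
    ⟨⟨0, by omega⟩, ⟨1, by omega⟩, by simp⟩
  have hzero : ∀ i j x, j ≠ i → (∀ y ∈ S, y j ≠ x j) → α i x = 0 := by
    intro i j x hji hx
    refine hsupp i x (fun h => hx x h rfl) fun h => hx _ h ?_
    simp [Pi.single_eq_of_ne hji]
  -- Integrate `α` along the line in direction `i₀`, starting from the hyperplane `x i₀ = c i₀`, on
  -- which the components transverse to `i₀` vanish.
  let P : ℕ → (Fin d → ZMod ℓ) → M := fun v x =>
    ∑ t ∈ Finset.range v, α i₀ (Function.update x i₀ (c i₀ + t))
  have hupd : ∀ (x : Fin d → ZMod ℓ) (v : ℕ),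
      Function.update x i₀ (c i₀ + ((v + 1 : ℕ) : ZMod ℓ)) =
        Function.update x i₀ (c i₀ + v) + Pi.single i₀ 1 := by
    intro x v
    ext k
    by_cases hk : k = i₀
    · subst hk
      simp [add_assoc]
    · simp [hk]
  have hupd' : ∀ (x : Fin d → ZMod ℓ) (j : Fin d) (a : ZMod ℓ), j ≠ i₀ →
      Function.update (x + Pi.single j 1) i₀ a = Function.update x i₀ a + Pi.single j 1 := by
    intro x j a hj
    ext k
    by_cases hk : k = i₀
    · subst hk
      simp [Pi.single_eq_of_ne hj.symm]
    · simp [hk]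
  have hbase : ∀ (x : Fin d → ZMod ℓ) (j : Fin d), j ≠ i₀ →
      α j (Function.update x i₀ (c i₀)) = 0 := by
    intro x j hj
    refine hzero j i₀ _ hj.symm fun y hy => ?_
    simpa using hc i₀ y hy
  have hP : ∀ (j : Fin d), j ≠ i₀ → ∀ (v : ℕ) x, P v (x + Pi.single j 1) - P v x =
      α j (Function.update x i₀ (c i₀ + v)) := by
    intro j hj v x
    induction v with
    | zero => simp [P, hbase x j hj]
    | succ v ih =>
      have h1 : P (v + 1) (x + Pi.single j 1) = P v (x + Pi.single j 1) +
          α i₀ (Function.update x i₀ (c i₀ + v) + Pi.single j 1) := by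
        simp only [P]
        rw [Finset.sum_range_succ, hupd' _ _ _ hj]
      have h2 : P (v + 1) x = P v x + α i₀ (Function.update x i₀ (c i₀ + v)) := by
        simp only [P]
        rw [Finset.sum_range_succ]
      have h3 := hclosed i₀ j (Function.update x i₀ (c i₀ + v))
      rw [h1, h2, hupd, sub_eq_iff_eq_add'.1 ih, add_assoc, ← h3]
      abel
  -- The period around the torus is zero: closedness lets the loop be moved in direction `j₀` into
  -- the hyperplane `x j₀ = c j₀`, where `α i₀` vanishes. Here `d ≥ 2` is needed.
  have hline : ∀ x, P ℓ x = 0 := by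
    have hstep : ∀ x, P ℓ (x + Pi.single j₀ 1) = P ℓ x := by
      intro x
      have := hP j₀ hij.symm ℓ x
      rw [ZMod.natCast_self, add_zero, hbase x j₀ hij.symm] at this
      exact sub_eq_zero.1 this
    have hsteps : ∀ (k : ℕ) x, P ℓ (x + Pi.single j₀ (k : ZMod ℓ)) = P ℓ x := by
      intro k x
      induction k with
      | zero => simp
      | succ k ih => rw [Nat.cast_succ, Pi.single_add, ← add_assoc, hstep, ih]
    intro x
    rw [← hsteps (c j₀ - x j₀).val x]
    refine Finset.sum_eq_zero fun t _ => hzero i₀ j₀ _ hij.symm fun y hy => ?_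
    simpa [hij.symm] using hc j₀ y hy
  let g : (Fin d → ZMod ℓ) → M := fun x => P (x i₀ - c i₀).val x
  have hself : ∀ x : Fin d → ZMod ℓ,
      Function.update x i₀ (c i₀ + (((x i₀ - c i₀).val : ℕ) : ZMod ℓ)) = x := by
    intro x
    simp
  have hPe : ∀ (v : ℕ) x, P v (x + Pi.single i₀ 1) = P v x := by
    intro v x
    refine Finset.sum_congr rfl fun t _ => ?_
    congr 1
    ext k
    by_cases hk : k = i₀
    · subst hk
      simp
    · simp [hk]
  have hg : ∀ i x, g (x + Pi.single i 1) - g x = α i x := by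
    intro i x
    by_cases hi : i = i₀
    · subst hi
      have hsucc : P ((x i - c i).val + 1) x = P (x i - c i).val x + α i x := by
        simp only [P]
        rw [Finset.sum_range_succ, hself]
      have hval : (x + Pi.single i 1 : Fin d → ZMod ℓ) i - c i =
          (((x i - c i).val + 1 : ℕ) : ZMod ℓ) := by
        simp
        ring
      have hlt := ZMod.val_lt (x i - c i)
      simp only [g]
      rw [hval, hPe, ZMod.val_natCast]
      rcases Nat.lt_or_eq_of_le (Nat.succ_le_of_lt hlt) with h | h
      · rw [Nat.mod_eq_of_lt h, hsucc]
        abel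
      · rw [Nat.succ_eq_add_one] at h
        have h0 := hline x
        rw [h, Nat.mod_self]
        rw [← h, hsucc] at h0
        have : P 0 x = 0 := rfl
        rw [this, zero_sub]
        exact neg_eq_of_add_eq_zero_right h0
    · have := hP i hi (x i₀ - c i₀).val x
      rw [hself] at this
      simp only [g]
      rw [← this]
      simp [Pi.single_eq_of_ne (Ne.symm hi)]
  have hg0 : ∀ x j, j ≠ i₀ → (∀ y ∈ S, y j ≠ x j) → g x = 0 := by
    intro x j hj hx
    refine Finset.sum_eq_zero fun t _ => hzero i₀ j _ hj fun y hy => ?_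
    simpa [hj] using hx y hy
  refine ⟨g, hg, fun x hx j => ?_⟩
  by_contra hne
  push Not at hne
  refine hx ?_
  -- If the coordinate `j ≠ i₀` of `x` is missed by `S`, the whole line of integration is. For `j =
  -- i₀`, the function `g` is constant in direction `j₀` through `x`, and it vanishes where that
  -- line meets `x j₀ = c j₀`.
  by_cases hj : j = i₀
  · subst hj
    have hsteps : ∀ k : ℕ, g (x + Pi.single j₀ (k : ZMod ℓ)) = g x := by
      intro k
      induction k with
      | zero => simp
      | succ k ih =>
        rw [Nat.cast_succ, Pi.single_add, ← add_assoc, ← ih]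
        refine sub_eq_zero.1 ((hg _ _).trans ?_)
        refine hzero j₀ j _ hij fun y hy => ?_
        simpa [Pi.single_eq_of_ne hij] using hne y hy
    rw [← hsteps (c j₀ - x j₀).val]
    refine hg0 _ j₀ hij.symm fun y hy => ?_
    simpa using hc j₀ y hy
  · exact hg0 x j hj hne

open scoped Classical in
/-- Remove from a labelling `s`, which is constant across the edges that avoid `Z`, the contours
that belong to the clusters of `Z` with at most `n` sites. -/
lemma exists_filling {d m n : ℕ} (hd : 2 ≤ d) {Z : Finset (Lattice d m)} {s : Lattice d m → ZMod 2}
    (hs : ∀ x y, (starGraph d m).Adj x y → x ∉ Z → y ∉ Z → s x = s y)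
    (hsmall : ∀ S ∈ clusters (starGraph d m) Z, S.card ≤ n → S.card < 2 ^ m) :
    ∃ v : Lattice d m → ZMod 2,
      (Finset.univ.filter fun x => v x ≠ s x).card ≤
        ∑ S ∈ clusters (starGraph d m) Z, (if S.card ≤ n then S.card ^ d else 0) ∧
      (Finset.univ.filter fun e : Fin d × Lattice d m =>
          v (e.2 + Pi.single e.1 1) ≠ v e.2).card ≤
        2 * d * ∑ S ∈ clusters (starGraph d m) Z, (if S.card ≤ n then 0 else S.card) := by
  have hnear : ∀ (x ε ε' : Lattice d m), (∀ k, ε k = 0 ∨ ε k = 1) → (∀ k, ε' k = 0 ∨ ε' k = 1) →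
      x + ε = x + ε' ∨ (starGraph d m).Adj (x + ε) (x + ε') := by
    intro x ε ε' h h'
    by_cases hne : x + ε = x + ε'
    · exact Or.inl hne
    · refine Or.inr ⟨hne, fun k => ?_⟩
      rcases h k with h | h <;> rcases h' k with h' | h' <;> simp [h, h']
  have hε0 : ∀ k, (0 : Lattice d m) k = 0 ∨ (0 : Lattice d m) k = 1 := fun k => Or.inl rfl
  have hε1 : ∀ (i : Fin d) k, (Pi.single i 1 : Lattice d m) k = 0 ∨
      (Pi.single i 1 : Lattice d m) k = 1 := fun i k => by
    by_cases h : k = i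
    · subst h
      simp
    · simp [h]
  have hε2 : ∀ (i j : Fin d), i ≠ j → ∀ k, (Pi.single i 1 + Pi.single j 1 : Lattice d m) k = 0 ∨
      (Pi.single i 1 + Pi.single j 1 : Lattice d m) k = 1 := fun i j hij k => by
    by_cases h : k = i
    · subst h
      simp [hij]
    · by_cases h' : k = j
      · subst h'
        simp [h]
      · simp [h, h']
  have hpot : ∀ S ∈ clusters (starGraph d m) Z, S.card ≤ n → ∃ g : Lattice d m → ZMod 2,
      (∀ i x, g (x + Pi.single i 1) - g x =
        if x ∈ S ∨ x + Pi.single i 1 ∈ S then s (x + Pi.single i 1) - s x else 0) ∧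
      ∀ x, g x ≠ 0 → ∀ j, ∃ y ∈ S, y j = x j := by
    intro S hS hSn
    have hc : ∀ j, ∃ c : ZMod (2 ^ m), ∀ y ∈ S, y j ≠ c := by
      intro j
      by_contra! hcon
      have : (Finset.univ : Finset (ZMod (2 ^ m))) ⊆ S.image fun y => y j := by
        intro c _
        obtain ⟨y, hy, hyc⟩ := hcon c
        exact Finset.mem_image.2 ⟨y, hy, hyc⟩
      have h1 := (Finset.card_le_card this).trans Finset.card_image_le
      rw [Finset.card_univ, ZMod.card] at h1
      exact absurd (hsmall S hS hSn) (not_lt.2 h1)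
    choose c hc using hc
    refine exists_potential hd (S := S) (α := fun i x =>
      if x ∈ S ∨ x + Pi.single i 1 ∈ S then s (x + Pi.single i 1) - s x else 0) ?_ ?_ hc
    · intro i j x
      by_cases hij : i = j
      · subst hij
        rfl
      -- Once a corner of a unit square lies in `S`, every zero among its corners lies in `S`. An
      -- edge of the square not touching `S` thus avoids `Z`, so `s` is constant across it, and the
      -- truncated coboundary agrees with the full one on the square.
      have key : ∀ ε ε' ε'' : Lattice d m, (∀ k, ε k = 0 ∨ ε k = 1) →
          (∀ k, ε' k = 0 ∨ ε' k = 1) → (∀ k, ε'' k = 0 ∨ ε'' k = 1) → x + ε ∈ S →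
          (if x + ε' ∈ S ∨ x + ε'' ∈ S then s (x + ε'') - s (x + ε') else 0) =
            s (x + ε'') - s (x + ε') := by
        intro ε ε' ε'' h h' h'' hε
        by_cases hin : x + ε' ∈ S ∨ x + ε'' ∈ S
        · rw [if_pos hin]
        · rw [if_neg hin]
          push Not at hin
          have hZ : ∀ η : Lattice d m, (∀ k, η k = 0 ∨ η k = 1) → x + η ∉ S → x + η ∉ Z := by
            intro η hη hnot hmem
            rcases hnear x ε η h hη with he | he
            · exact hnot (he ▸ hε)
            · exact hnot (mem_of_adj_of_mem_clusters hS hε hmem he)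
          rcases hnear x ε' ε'' h' h'' with he | he
          · rw [he, sub_self]
          · rw [hs _ _ he (hZ _ h' hin.1) (hZ _ h'' hin.2), sub_self]
      have hx0 : x = x + 0 := (add_zero x).symm
      have hcomm : x + Pi.single j 1 + Pi.single i 1 =
          x + (Pi.single i 1 + Pi.single j 1) := by
        rw [add_assoc, add_comm (Pi.single j 1)]
      have main : ∀ ε : Lattice d m, (∀ k, ε k = 0 ∨ ε k = 1) → x + ε ∈ S →
          (if x + 0 ∈ S ∨ x + Pi.single i 1 ∈ S then s (x + Pi.single i 1) - s (x + 0) else 0) +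
          (if x + Pi.single i 1 ∈ S ∨ x + (Pi.single i 1 + Pi.single j 1) ∈ S then
            s (x + (Pi.single i 1 + Pi.single j 1)) - s (x + Pi.single i 1) else 0) =
          (if x + 0 ∈ S ∨ x + Pi.single j 1 ∈ S then s (x + Pi.single j 1) - s (x + 0) else 0) +
          (if x + Pi.single j 1 ∈ S ∨ x + (Pi.single i 1 + Pi.single j 1) ∈ S then
            s (x + (Pi.single i 1 + Pi.single j 1)) - s (x + Pi.single j 1) else 0) := by
        intro ε h hε
        rw [key ε _ _ h hε0 (hε1 i) hε, key ε _ _ h (hε1 i) (hε2 i j hij) hε,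
          key ε _ _ h hε0 (hε1 j) hε, key ε _ _ h (hε1 j) (hε2 i j hij) hε]
        abel
      rw [hcomm, add_assoc x]
      rw [add_zero] at main
      by_cases h0 : x ∈ S
      · exact main 0 hε0 (by rwa [add_zero])
      by_cases h1 : x + Pi.single i 1 ∈ S
      · exact main _ (hε1 i) h1
      by_cases h2 : x + Pi.single j 1 ∈ S
      · exact main _ (hε1 j) h2
      by_cases h3 : x + (Pi.single i 1 + Pi.single j 1) ∈ S
      · exact main _ (hε2 i j hij) h3
      simp [h0, h1, h2, h3]
    · intro i x h1 h2
      simp [h1, h2]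
  choose! g hg hgsupp using hpot
  set C := clusters (starGraph d m) Z with hC
  set C₁ := C.filter fun S => S.card ≤ n with hC₁
  set C₂ := C.filter fun S => ¬ S.card ≤ n with hC₂
  have hmem₁ : ∀ S ∈ C₁, S ∈ C ∧ S.card ≤ n := fun S hS => Finset.mem_filter.1 hS
  refine ⟨fun x => s x - ∑ S ∈ C₁, g S x, ?_, ?_⟩
  · rw [← Finset.sum_filter, ← hC₁]
    have hsub : (Finset.univ.filter fun x => s x - ∑ S ∈ C₁, g S x ≠ s x) ⊆
        C₁.biUnion fun S => Fintype.piFinset fun j => S.image fun y => y j := by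
      intro x hx
      simp only [Finset.mem_filter, Finset.mem_univ, true_and, ne_eq, sub_eq_self] at hx
      obtain ⟨S, hS, hgS⟩ := Finset.exists_ne_zero_of_sum_ne_zero hx
      refine Finset.mem_biUnion.2 ⟨S, hS, Fintype.mem_piFinset.2 fun j => ?_⟩
      obtain ⟨y, hy, hyj⟩ := hgsupp S (hmem₁ S hS).1 (hmem₁ S hS).2 x hgS j
      exact Finset.mem_image.2 ⟨y, hy, hyj⟩
    refine (Finset.card_le_card hsub).trans (Finset.card_biUnion_le.trans ?_)
    refine Finset.sum_le_sum fun S _ => ?_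
    rw [Fintype.card_piFinset]
    calc ∏ j : Fin d, (S.image fun y => y j).card ≤ ∏ _j : Fin d, S.card :=
          Finset.prod_le_prod' fun j _ => Finset.card_image_le
      _ = S.card ^ d := by simp
  · have h2 : (∑ S ∈ C, if S.card ≤ n then 0 else S.card) = ∑ S ∈ C₂, S.card := by
      rw [hC₂, Finset.sum_filter]
      exact Finset.sum_congr rfl fun S _ => by split_ifs <;> rfl
    rw [h2]
    have hsub : (Finset.univ.filter fun e : Fin d × Lattice d m =>
        s (e.2 + Pi.single e.1 1) - ∑ S ∈ C₁, g S (e.2 + Pi.single e.1 1) ≠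
          s e.2 - ∑ S ∈ C₁, g S e.2) ⊆
        C₂.biUnion fun S => (Finset.univ ×ˢ S) ∪
          -- A surviving jump starts or ends in a large cluster; each of its sites has `d` outgoing
          -- and `d` incoming edges, whence the factor `2 * d`.
          (Finset.univ ×ˢ S).image fun e : Fin d × Lattice d m => (e.1, e.2 - Pi.single e.1 1) := by
      rintro ⟨i, x⟩ he
      simp only [Finset.mem_filter, Finset.mem_univ, true_and] at he
      have he' : (s (x + Pi.single i 1) - s x) -
          ∑ S ∈ C₁, (if x ∈ S ∨ x + Pi.single i 1 ∈ S then s (x + Pi.single i 1) - s x else 0)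
            ≠ 0 := by
        rw [← Finset.sum_congr rfl fun S hS => hg S (hmem₁ S hS).1 (hmem₁ S hS).2 i x,
          Finset.sum_sub_distrib]
        intro h
        refine he (sub_eq_zero.1 ?_)
        rw [← h]
        abel
      have hadj : x = x + Pi.single i 1 ∨ (starGraph d m).Adj x (x + Pi.single i 1) := by
        simpa using hnear x 0 (Pi.single i 1) hε0 (hε1 i)
      have hds : s (x + Pi.single i 1) - s x ≠ 0 := by
        intro h
        refine he' ?_
        simp [h]
      have hadj' : (starGraph d m).Adj x (x + Pi.single i 1) := by
        rcases hadj with h | h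
        · rw [← h, sub_self] at hds
          exact absurd rfl hds
        · exact h
      have huniq : ∀ S ∈ C, ∀ T ∈ C, (x ∈ S ∨ x + Pi.single i 1 ∈ S) →
          (x ∈ T ∨ x + Pi.single i 1 ∈ T) → S = T := by
        intro S hS T hT h1 h2
        have aux : ∀ y, y ∈ S → y ∈ T → S = T := fun y hy hy' => by
          rw [← cluster_eq_of_mem_clusters hS hy, ← cluster_eq_of_mem_clusters hT hy']
        rcases h1 with h1 | h1 <;> rcases h2 with h2 | h2
        · exact aux _ h1 h2
        · exact aux _ h1 (mem_of_adj_of_mem_clusters hT h2 (subset_of_mem_clusters hS h1) hadj'.symm)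
        · exact aux _ h1 (mem_of_adj_of_mem_clusters hT h2 (subset_of_mem_clusters hS h1) hadj')
        · exact aux _ h1 h2
      have htouch : ∃ S ∈ C, x ∈ S ∨ x + Pi.single i 1 ∈ S := by
        by_cases h1 : x ∈ Z
        · exact ⟨_, cluster_mem_clusters h1, Or.inl (self_mem_cluster _ _)⟩
        by_cases h2 : x + Pi.single i 1 ∈ Z
        · exact ⟨_, cluster_mem_clusters h2, Or.inr (self_mem_cluster _ _)⟩
        exact absurd (sub_eq_zero.2 (hs _ _ hadj' h1 h2).symm) hds
      obtain ⟨S, hS, hxS⟩ := htouch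
      have hS2 : S ∈ C₂ := by
        refine Finset.mem_filter.2 ⟨hS, fun hle => he' ?_⟩
        rw [Finset.sum_eq_single_of_mem S (Finset.mem_filter.2 ⟨hS, hle⟩), if_pos hxS, sub_self]
        intro T hT hTS
        exact if_neg fun h => hTS (huniq T (hmem₁ T hT).1 S hS h hxS)
      refine Finset.mem_biUnion.2 ⟨S, hS2, ?_⟩
      rw [Finset.mem_union]
      rcases hxS with h | h
      · exact Or.inl (by simp [h])
      · refine Or.inr (Finset.mem_image.2 ⟨(i, x + Pi.single i 1), by simp [h], ?_⟩)
        simp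
    refine (Finset.card_le_card hsub).trans (Finset.card_biUnion_le.trans ?_)
    rw [Finset.mul_sum]
    refine Finset.sum_le_sum fun S _ => (Finset.card_union_le _ _).trans ?_
    have h3 : (Finset.univ ×ˢ S : Finset (Fin d × Lattice d m)).card = d * S.card := by
      rw [Finset.card_product, Finset.card_univ, Fintype.card_fin]
    have h4 := (Finset.card_image_le (s := (Finset.univ ×ˢ S : Finset (Fin d × Lattice d m)))
      (f := fun e : Fin d × Lattice d m => (e.1, e.2 - Pi.single e.1 1)))
    rw [h3] at h4 ⊢
    linarith

end Cochains

/-! ### Half-open cells of the unit torus -/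

section Cells

lemma periodic_floor_mul (ℓ : ℕ) :
    Function.Periodic (fun r : ℝ => ((⌊(ℓ : ℝ) * r⌋ : ℤ) : ZMod ℓ)) 1 := by
  intro r
  have : (ℓ : ℝ) * (r + 1) = ℓ * r + ((ℓ : ℤ) : ℝ) := by
    push_cast
    ring
  simp only [this, Int.floor_add_intCast]
  simp

/-- The index of the arc `[y / ℓ, (y + 1) / ℓ)` that contains a point of the unit circle. -/
def circleCell (ℓ : ℕ) : UnitAddCircle → ZMod ℓ := (periodic_floor_mul ℓ).lift

lemma circleCell_coe (ℓ : ℕ) (r : ℝ) :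
    circleCell ℓ (r : UnitAddCircle) = ((⌊(ℓ : ℝ) * r⌋ : ℤ) : ZMod ℓ) :=
  Function.Periodic.lift_coe _ r

lemma exists_coe_eq (θ : UnitAddCircle) : ∃ r : ℝ, (r : UnitAddCircle) = θ :=
  QuotientAddGroup.mk_surjective θ

lemma measurable_circleCell (ℓ : ℕ) : Measurable (circleCell ℓ) := by
  have h : circleCell ℓ = fun θ =>
      ((⌊(ℓ : ℝ) * (AddCircle.measurableEquivIoc (1 : ℝ) 0 θ : ℝ)⌋ : ℤ) : ZMod ℓ) := by
    ext θ
    rw [← circleCell_coe]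
    congr 1
    exact ((AddCircle.measurableEquivIoc (1 : ℝ) 0).symm_apply_apply θ).symm
  rw [h]
  refine (measurable_from_top (f := fun j : ℤ => (j : ZMod ℓ))).comp ?_
  exact Int.measurable_floor.comp
    ((measurable_subtype_coe.comp (AddCircle.measurableEquivIoc (1 : ℝ) 0).measurable).const_mul _)

/-- The arc lies in a closed ball about its midpoint, whose volume is explicit. -/
lemma volume_arc_le {A : Set UnitAddCircle} {a b : ℝ}
    (h : ∀ θ ∈ A, ∃ r ∈ Set.Icc a b, (r : UnitAddCircle) = θ) :
    volume A ≤ ENNReal.ofReal (b - a) := by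
  have hsub : A ⊆ Metric.closedBall (((a + b) / 2 : ℝ) : UnitAddCircle) ((b - a) / 2) := by
    intro θ hθ
    obtain ⟨r, hr, rfl⟩ := h θ hθ
    rw [Metric.mem_closedBall, dist_eq_norm, ← AddCircle.coe_sub]
    refine (QuotientAddGroup.norm_mk_le_norm (m := r - (a + b) / 2)).trans ?_
    rw [Real.norm_eq_abs, abs_le]
    constructor <;> linarith [hr.1, hr.2]
  refine (measure_mono hsub).trans ?_
  rw [AddCircle.volume_closedBall]
  refine ENNReal.ofReal_le_ofReal ?_
  linarith [min_le_right (1 : ℝ) (2 * ((b - a) / 2))]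

variable {ℓ : ℕ} [NeZero ℓ]

/-- A point of the arc with index `y` is represented in `[y / ℓ, (y + 1) / ℓ)`. -/
lemma exists_rep_of_circleCell_eq {θ : UnitAddCircle} {y : ZMod ℓ} (h : circleCell ℓ θ = y) :
    ∃ r : ℝ, (r : UnitAddCircle) = θ ∧ ⌊(ℓ : ℝ) * r⌋ = (y.val : ℤ) := by
  obtain ⟨r, rfl⟩ := exists_coe_eq θ
  rw [circleCell_coe] at h
  have h1 : ((⌊(ℓ : ℝ) * r⌋ : ℤ) : ZMod ℓ) = ((y.val : ℤ) : ZMod ℓ) := by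
    rw [h]
    simp
  rw [ZMod.intCast_eq_intCast_iff] at h1
  obtain ⟨k, hk⟩ := h1.dvd
  refine ⟨r + k, ?_, ?_⟩
  · rw [AddCircle.coe_add]
    have : ((k : ℝ) : UnitAddCircle) = 0 := by
      rw [AddCircle.coe_eq_zero_iff]
      exact ⟨k, by simp⟩
    rw [this, add_zero]
  · have : (ℓ : ℝ) * (r + k) = ℓ * r + ((ℓ * k : ℤ) : ℝ) := by
      push_cast
      ring
    rw [this, Int.floor_add_intCast, ← hk]
    ring

lemma volume_circleCell_le (y : ZMod ℓ) :
    volume {θ | circleCell ℓ θ = y} ≤ ENNReal.ofReal (1 / ℓ) := by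
  have hℓ : (0 : ℝ) < ℓ := by exact_mod_cast Nat.pos_of_ne_zero (NeZero.ne ℓ)
  have := volume_arc_le (A := {θ | circleCell ℓ θ = y}) (a := y.val / ℓ) (b := (y.val + 1) / ℓ) ?_
  · refine this.trans (ENNReal.ofReal_le_ofReal (le_of_eq ?_))
    ring
  · intro θ hθ
    obtain ⟨r, hr, hfl⟩ := exists_rep_of_circleCell_eq hθ
    rw [Int.floor_eq_iff] at hfl
    push_cast at hfl
    refine ⟨r, ⟨?_, ?_⟩, hr⟩
    · rw [div_le_iff₀ hℓ]
      linarith [hfl.1]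
    · rw [le_div_iff₀ hℓ]
      linarith [hfl.2]

lemma circleCell_sub {t : ℝ} (ht : 0 < t) (ht1 : t * ℓ ≤ 1) (θ : UnitAddCircle) :
    circleCell ℓ (θ - t) = circleCell ℓ θ ∨ circleCell ℓ (θ - t) = circleCell ℓ θ - 1 := by
  have hℓ : (0 : ℝ) < ℓ := by exact_mod_cast Nat.pos_of_ne_zero (NeZero.ne ℓ)
  obtain ⟨r, rfl⟩ := exists_coe_eq θ
  rw [← AddCircle.coe_sub, circleCell_coe, circleCell_coe]
  have h1 := Int.floor_le ((ℓ : ℝ) * r)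
  have h2 := Int.lt_floor_add_one ((ℓ : ℝ) * r)
  have h3 : 0 < t * ℓ := by positivity
  by_cases h : (⌊(ℓ : ℝ) * r⌋ : ℝ) ≤ ℓ * (r - t)
  · left
    rw [Int.floor_eq_iff.2 ⟨h, by linarith⟩]
  · right
    have : ⌊(ℓ : ℝ) * (r - t)⌋ = ⌊(ℓ : ℝ) * r⌋ - 1 := by
      rw [Int.floor_eq_iff]
      push_cast
      constructor <;> linarith
    rw [this]
    push_cast
    rfl

lemma volume_circleCell_change_le {t : ℝ} (ht : 0 < t) (y : ZMod ℓ) :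
    volume {θ : UnitAddCircle | circleCell ℓ θ = y ∧ circleCell ℓ (θ - t) ≠ y} ≤
      ENNReal.ofReal t := by
  have hℓ : (0 : ℝ) < ℓ := by exact_mod_cast Nat.pos_of_ne_zero (NeZero.ne ℓ)
  have := volume_arc_le (A := {θ : UnitAddCircle | circleCell ℓ θ = y ∧ circleCell ℓ (θ - t) ≠ y})
    (a := y.val / ℓ) (b := y.val / ℓ + t) ?_
  · refine this.trans (ENNReal.ofReal_le_ofReal (le_of_eq ?_))
    ring
  · rintro θ ⟨hθ, hθt⟩
    obtain ⟨r, hr, hfl⟩ := exists_rep_of_circleCell_eq hθ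
    have hfl' := hfl
    rw [Int.floor_eq_iff] at hfl
    push_cast at hfl
    refine ⟨r, ⟨?_, ?_⟩, hr⟩
    · rw [div_le_iff₀ hℓ]
      linarith [hfl.1]
    · by_contra hlt
      push Not at hlt
      refine hθt ?_
      rw [← hr, ← AddCircle.coe_sub, circleCell_coe]
      have h1 : (y.val : ℝ) ≤ ℓ * (r - t) := by
        have := (div_lt_iff₀ hℓ).1 (lt_sub_iff_add_lt.2 hlt)
        linarith
      have : ⌊(ℓ : ℝ) * (r - t)⌋ = (y.val : ℤ) := by
        rw [Int.floor_eq_iff]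
        push_cast
        have : 0 < t * ℓ := by positivity
        exact ⟨h1, by linarith [hfl.2]⟩
      rw [this]
      simp

/-- Membership in a centred arc, in terms of the half-open cells. -/
lemma exists_mem_Ico_iff (θ : UnitAddCircle) (x : ZMod ℓ) :
    (∃ t : ℝ, t ∈ Set.Ico (-(1 / (2 * ℓ : ℝ))) (1 / (2 * ℓ)) ∧
        θ = ZMod.toAddCircle x + (t : UnitAddCircle)) ↔
      circleCell ℓ (θ + ((1 / (2 * ℓ) : ℝ) : UnitAddCircle)) = x := by
  have hℓ : (0 : ℝ) < ℓ := by exact_mod_cast Nat.pos_of_ne_zero (NeZero.ne ℓ)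
  have hx : ZMod.toAddCircle x = (((x.val : ℤ) / ℓ : ℝ) : UnitAddCircle) := by
    rw [← ZMod.toAddCircle_intCast]
    simp
  constructor
  · rintro ⟨t, ht, rfl⟩
    rw [hx, ← AddCircle.coe_add, ← AddCircle.coe_add, circleCell_coe]
    have h1 : (ℓ : ℝ) * ((x.val : ℤ) / ℓ + t + 1 / (2 * ℓ)) = (x.val : ℤ) + (ℓ * t + 1 / 2) := by
      field_simp
      ring
    have h2 : -(1 / 2) ≤ (ℓ : ℝ) * t := by
      have := mul_le_mul_of_nonneg_left ht.1 hℓ.le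
      have h3 : (ℓ : ℝ) * (-(1 / (2 * ℓ))) = -(1 / 2) := by field_simp
      linarith
    have h3 : (ℓ : ℝ) * t < 1 / 2 := by
      have := mul_lt_mul_of_pos_left ht.2 hℓ
      have h3 : (ℓ : ℝ) * (1 / (2 * ℓ)) = 1 / 2 := by field_simp
      linarith
    rw [h1, Int.floor_intCast_add]
    have : ⌊(ℓ : ℝ) * t + 1 / 2⌋ = 0 := by
      rw [Int.floor_eq_iff]
      push_cast
      constructor <;> linarith
    rw [this]
    simp
  · intro h
    obtain ⟨r, hr, hfl⟩ := exists_rep_of_circleCell_eq h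
    have hθ : θ = ((r - 1 / (2 * ℓ) : ℝ) : UnitAddCircle) := by
      rw [AddCircle.coe_sub, hr]
      abel
    rw [Int.floor_eq_iff] at hfl
    refine ⟨r - 1 / (2 * ℓ) - (x.val : ℤ) / ℓ, ⟨?_, ?_⟩, ?_⟩
    · have : ((x.val : ℤ) : ℝ) / ℓ ≤ r := by
        rw [div_le_iff₀ hℓ]
        linarith [hfl.1]
      linarith
    · have : r < ((x.val : ℤ) : ℝ) / ℓ + 1 / ℓ := by
        rw [← add_div, lt_div_iff₀ hℓ]
        linarith [hfl.2]
      have h2 : (1 : ℝ) / ℓ = 1 / (2 * ℓ) + 1 / (2 * ℓ) := by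
        field_simp
        norm_num
      linarith
    · rw [hx, ← AddCircle.coe_add, hθ]
      congr 1
      ring

/-- A half-open cell is contained in a single centred arc of even relative length. -/
lemma circleCell_toAddCircle_circleCell {L c : ℕ} [NeZero L] (hL : ℓ * (2 * c) = L)
    (θ : UnitAddCircle) :
    circleCell ℓ ((ZMod.toAddCircle (circleCell L θ)) + ((1 / (2 * ℓ) : ℝ) : UnitAddCircle)) =
      circleCell ℓ (θ + ((1 / (2 * ℓ) : ℝ) : UnitAddCircle)) := by
  have hℓ : (0 : ℝ) < ℓ := by exact_mod_cast Nat.pos_of_ne_zero (NeZero.ne ℓ)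
  have hL0 : (0 : ℝ) < L := by exact_mod_cast Nat.pos_of_ne_zero (NeZero.ne L)
  have hLR : (L : ℝ) = ℓ * (2 * c) := by exact_mod_cast hL.symm
  have hc : (0 : ℝ) < c := by
    rw [hLR] at hL0
    by_contra hcon
    have : (c : ℝ) = 0 := le_antisymm (not_lt.1 hcon) (Nat.cast_nonneg c)
    simp [this] at hL0
  obtain ⟨r, rfl⟩ := exists_coe_eq θ
  rw [circleCell_coe, ZMod.toAddCircle_intCast, ← AddCircle.coe_add, ← AddCircle.coe_add,
    circleCell_coe, circleCell_coe]
  congr 1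
  -- Both sides become a floor division by `2 * c` after the shift by `c`. As `c` and `2 * c` are
  -- integers, rounding `L * r` down beforehand changes nothing.
  have h1 : (ℓ : ℝ) * ((⌊(L : ℝ) * r⌋ : ℤ) / L + 1 / (2 * ℓ)) =
      (((⌊(L : ℝ) * r⌋ + c : ℤ)) : ℝ) / ((2 * c : ℕ) : ℝ) := by
    rw [hLR]
    push_cast
    field_simp
  have h2 : (ℓ : ℝ) * (r + 1 / (2 * ℓ)) = (L * r + ((c : ℤ) : ℝ)) / ((2 * c : ℕ) : ℝ) := by
    rw [hLR]
    push_cast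
    field_simp
  rw [h1, h2, Int.floor_div_natCast, Int.floor_div_natCast, Int.floor_intCast,
    Int.floor_add_intCast]

end Cells

/-! ### Cells and centred boxes in the `d`-dimensional torus -/

section TorusCells

variable {d : ℕ}

/-- The index of the half-open cell of side length `2^{-m}` that contains a point of the torus. -/
def cell (m : ℕ) (p : UnitAddTorus (Fin d)) : Lattice d m := fun i => circleCell (2 ^ m) (p i)

/-- The index of the centred box of side length `2^{-m}` that contains a point of the torus. -/
def boxIndex (m : ℕ) (p : UnitAddTorus (Fin d)) : Lattice d m := fun i =>
  circleCell (2 ^ m) (p i + ((1 / (2 * (2 ^ m : ℕ)) : ℝ) : UnitAddCircle))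

lemma measurable_cell (m : ℕ) : Measurable (cell m : UnitAddTorus (Fin d) → Lattice d m) :=
  measurable_pi_lambda _ fun i => (measurable_circleCell _).comp (measurable_pi_apply i)

lemma measurable_boxIndex (m : ℕ) :
    Measurable (boxIndex m : UnitAddTorus (Fin d) → Lattice d m) :=
  measurable_pi_lambda _ fun i => (measurable_circleCell _).comp
    ((measurable_pi_apply i).add_const _)

lemma mem_box_iff {m : ℕ} {x : Lattice d m} {q : UnitAddTorus (Fin d)} :
    q ∈ box m (site x) ↔ boxIndex m q = x := by
  have h : ((1 : ℝ) / 2 ^ (m + 1)) = 1 / (2 * (2 ^ m : ℕ)) := by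
    push_cast
    rw [pow_succ']
  simp only [box, site, Set.mem_ofPred_eq, h, exists_mem_Ico_iff, funext_iff, boxIndex]

lemma mem_box_boxIndex (m : ℕ) (q : UnitAddTorus (Fin d)) : q ∈ box m (site (boxIndex m q)) :=
  mem_box_iff.2 rfl

/-- Centred boxes of different scales are not nested, but a half-open cell of a strictly finer scale
lies in one coarse box together with its corner site. Fine sign fields are therefore placed on
cells. -/
lemma boxIndex_site_cell {m M : ℕ} (h : m < M) (p : UnitAddTorus (Fin d)) :
    boxIndex m (site (cell M p)) = boxIndex m p := by
  ext i
  simp only [boxIndex, site, cell]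
  refine circleCell_toAddCircle_circleCell (c := 2 ^ (M - m - 1)) ?_ (p i)
  rw [← pow_succ', ← pow_add]
  congr 1
  omega

lemma boxIndex_site {m : ℕ} (x : Lattice d m) : boxIndex m (site x) = x := by
  refine mem_box_iff.1 fun i => ⟨0, ⟨by simp, by positivity⟩, by simp⟩

lemma volume_cell_le (m : ℕ) (y : Lattice d m) :
    volume {p : UnitAddTorus (Fin d) | cell m p = y} ≤ ENNReal.ofReal ((1 / 2 ^ m) ^ d) := by
  have h : {p : UnitAddTorus (Fin d) | cell m p = y} =
      Set.univ.pi fun i => {θ | circleCell (2 ^ m) θ = y i} := by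
    ext p
    simp [cell, funext_iff]
  rw [h, volume_pi_pi, ENNReal.ofReal_pow (by positivity)]
  calc _ ≤ ∏ _i : Fin d, ENNReal.ofReal (1 / 2 ^ m) :=
        Finset.prod_le_prod' fun i _ => by simpa using volume_circleCell_le (y i)
    _ = _ := by simp

lemma volume_boxIndex_le (m : ℕ) (y : Lattice d m) :
    volume {p : UnitAddTorus (Fin d) | boxIndex m p = y} ≤ ENNReal.ofReal ((1 / 2 ^ m) ^ d) := by
  refine le_trans (le_of_eq ?_) (volume_cell_le m y)
  have h : {p : UnitAddTorus (Fin d) | boxIndex m p = y} =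
      (fun p => p + fun _ => ((1 / (2 * (2 ^ m : ℕ)) : ℝ) : UnitAddCircle)) ⁻¹'
        {p : UnitAddTorus (Fin d) | cell m p = y} := rfl
  rw [h, measure_preimage_add_right]

lemma volume_index_mem_le {m : ℕ} {f : UnitAddTorus (Fin d) → Lattice d m}
    (hf : ∀ y, volume {p | f p = y} ≤ ENNReal.ofReal ((1 / 2 ^ m) ^ d))
    (B : Finset (Lattice d m)) :
    volume.real {p | f p ∈ B} ≤ B.card * (1 / 2 ^ m) ^ d := by
  have h : {p | f p ∈ B} = ⋃ y ∈ B, {p | f p = y} := by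
    ext p
    simp
  refine ENNReal.toReal_le_of_le_ofReal (by positivity) ?_
  rw [h]
  refine (measure_biUnion_finset_le B _).trans ((Finset.sum_le_sum fun y _ => hf y).trans ?_)
  rw [Finset.sum_const, nsmul_eq_mul, ENNReal.ofReal_mul (by positivity), ENNReal.ofReal_natCast]

/-- Sets of the box algebra are unions of boxes. -/
lemma mem_iff_of_boxIndex_eq {m : ℕ} {A : Set (UnitAddTorus (Fin d))}
    (hA : MeasurableSet[boxAlgebra d m] A) {p q : UnitAddTorus (Fin d)}
    (h : boxIndex m p = boxIndex m q) : p ∈ A ↔ q ∈ A := by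
  induction A, hA using MeasurableSpace.generateFrom_induction with
  | hC A hA _ =>
    obtain ⟨x, rfl⟩ := hA
    rw [mem_box_iff, mem_box_iff, h]
  | empty => rfl
  | compl A _ ih => exact not_congr ih
  | iUnion f _ ih => simp only [Set.mem_iUnion, ih]

lemma IsPhaseLabel.eq_of_boxIndex_eq {m : ℕ} {w : UnitAddTorus (Fin d) → ℝ}
    (hw : IsPhaseLabel m w) {p q : UnitAddTorus (Fin d)} (h : boxIndex m p = boxIndex m q) :
    w p = w q := by
  have := (mem_iff_of_boxIndex_eq (hw.2 (measurableSet_singleton (w q))) h).2 rfl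
  exact this

lemma IsPhaseLabel.eq_site_boxIndex {m : ℕ} {w : UnitAddTorus (Fin d) → ℝ}
    (hw : IsPhaseLabel m w) (p : UnitAddTorus (Fin d)) : w p = w (site (boxIndex m p)) :=
  hw.eq_of_boxIndex_eq (boxIndex_site _).symm

lemma IsPhaseLabel.measurable {m : ℕ} {w : UnitAddTorus (Fin d) → ℝ} (hw : IsPhaseLabel m w) :
    Measurable w := by
  have h : w = (fun x : Lattice d m => w (site x)) ∘ boxIndex m := by
    ext p
    exact hw.eq_site_boxIndex p
  rw [h]
  exact (measurable_of_countable _).comp (measurable_boxIndex m)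

lemma IsPhaseLabel.eq_site_cell {m M : ℕ} (h : m < M) {w : UnitAddTorus (Fin d) → ℝ}
    (hw : IsPhaseLabel m w) (p : UnitAddTorus (Fin d)) : w p = w (site (cell M p)) :=
  hw.eq_of_boxIndex_eq (boxIndex_site_cell h p).symm

end TorusCells

/-! ### The perimeter of a union of cells -/

section Perimeter

variable {d : ℕ}

/-- The translation of the torus by the real number `t` in direction `i`. -/
def shift (i : Fin d) (t : ℝ) : UnitAddTorus (Fin d) := Pi.single i (t : UnitAddCircle)

lemma shift_add (i : Fin d) (s t : ℝ) : shift i (s + t) = shift i s + shift i t := by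
  simp only [shift, AddCircle.coe_add, Pi.single_add]

lemma shift_zero (i : Fin d) : shift i 0 = 0 := by
  simp [shift]

lemma isOpenQuotientMap_torus :
    IsOpenQuotientMap (fun (x : Fin d → ℝ) (i : Fin d) => (x i : UnitAddCircle)) :=
  IsOpenQuotientMap.piMap (f := fun (_ : Fin d) (r : ℝ) => (r : UnitAddCircle))
    fun _ => QuotientAddGroup.isOpenQuotientMap_mk

lemma coe_add_shift (x : Fin d → ℝ) (i : Fin d) (t : ℝ) :
    (fun j => (x j : UnitAddCircle)) + shift i t =
      fun j => (((x + Pi.single i t : Fin d → ℝ) j : ℝ) : UnitAddCircle) := by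
  ext j
  by_cases h : j = i
  · subst h
    simp [shift]
  · simp [shift, h]

variable {φ : UnitAddTorus (Fin d) → EuclideanSpace ℝ (Fin d)}

lemma IsTestField.continuous (hφ : IsTestField φ) : Continuous φ :=
  isOpenQuotientMap_torus.isQuotientMap.continuous_iff.2 hφ.1.continuous

lemma IsTestField.hasDerivAt_coe (hφ : IsTestField φ) (x : Fin d → ℝ) (i : Fin d) :
    HasDerivAt (fun t : ℝ => φ ((fun j => (x j : UnitAddCircle)) + shift i t) i)
      (fderiv ℝ (fun x : Fin d → ℝ => φ (fun i => (x i : UnitAddCircle))) x (Pi.single i 1) i)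
      0 := by
  simp_rw [coe_add_shift]
  set Φ : (Fin d → ℝ) → EuclideanSpace ℝ (Fin d) :=
    fun x => φ (fun i => (x i : UnitAddCircle)) with hΦ
  have h1 : HasFDerivAt Φ (fderiv ℝ Φ x) (x + Pi.single i (0 : ℝ)) := by
    rw [Pi.single_zero, add_zero]
    exact (hφ.1.differentiable (by norm_num) x).hasFDerivAt
  have h2 : HasDerivAt (fun t : ℝ => x + Pi.single i t) (Pi.single i (1 : ℝ)) 0 := by
    refine HasDerivAt.const_add x ?_
    rw [hasDerivAt_pi]
    intro j
    by_cases h : j = i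
    · subst h
      simpa using hasDerivAt_id' (0 : ℝ)
    · simpa [h] using hasDerivAt_const (0 : ℝ) (0 : ℝ)
  have h3 : HasDerivAt (fun t : ℝ => Φ (x + Pi.single i t)) (fderiv ℝ Φ x (Pi.single i 1)) 0 :=
    HasFDerivAt.comp_hasDerivAt (l := Φ) (0 : ℝ) h1 h2
  exact ((EuclideanSpace.proj (𝕜 := ℝ) i).hasFDerivAt).comp_hasDerivAt (0 : ℝ) h3

/-- The partial derivative in direction `i` of the `i`-th component of a vector field. -/
def partialDeriv (φ : UnitAddTorus (Fin d) → EuclideanSpace ℝ (Fin d)) (i : Fin d)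
    (p : UnitAddTorus (Fin d)) : ℝ :=
  deriv (fun t : ℝ => φ (p + shift i t) i) 0

lemma IsTestField.hasDerivAt (hφ : IsTestField φ) (i : Fin d) (p : UnitAddTorus (Fin d)) (t : ℝ) :
    HasDerivAt (fun t : ℝ => φ (p + shift i t) i) (partialDeriv φ i (p + shift i t)) t := by
  obtain ⟨x, hx⟩ := isOpenQuotientMap_torus.surjective (p + shift i t)
  have h0 := hφ.hasDerivAt_coe x i
  simp only at hx
  rw [hx] at h0
  have h1 : HasDerivAt (fun s : ℝ => φ (p + shift i t + shift i s) i)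
      (partialDeriv φ i (p + shift i t)) (t - t) := by
    rw [sub_self]
    exact h0.differentiableAt.hasDerivAt
  have h2 := HasDerivAt.comp_sub_const t t h1
  refine h2.congr_of_eventuallyEq (Eventually.of_forall fun s => ?_)
  simp only
  rw [add_assoc, ← shift_add, add_sub_cancel]

lemma IsTestField.continuous_partialDeriv (hφ : IsTestField φ) (i : Fin d) :
    Continuous (partialDeriv φ i) := by
  refine isOpenQuotientMap_torus.isQuotientMap.continuous_iff.2 ?_
  have h : partialDeriv φ i ∘ (fun (x : Fin d → ℝ) (i : Fin d) => (x i : UnitAddCircle)) =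
      fun x => fderiv ℝ (fun x : Fin d → ℝ => φ (fun i => (x i : UnitAddCircle))) x
        (Pi.single i 1) i := by
    ext x
    exact (hφ.hasDerivAt_coe x i).deriv
  rw [h]
  have h1 := (hφ.1.continuous_fderiv (by norm_num)).clm_apply
    (continuous_const (y := (Pi.single i 1 : Fin d → ℝ)))
  exact (EuclideanSpace.proj (𝕜 := ℝ) i).continuous.comp h1

lemma IsTestField.exists_bound (hφ : IsTestField φ) (i : Fin d) :
    ∃ C : ℝ, ∀ p, ‖partialDeriv φ i p‖ ≤ C := by
  obtain ⟨C, hC⟩ := isCompact_univ.exists_bound_of_continuousOn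
    (hφ.continuous_partialDeriv i).continuousOn
  exact ⟨C, fun p => hC p (Set.mem_univ p)⟩

lemma IsTestField.abs_apply_le (hφ : IsTestField φ) (i : Fin d) (p : UnitAddTorus (Fin d)) :
    ‖φ p i‖ ≤ 1 :=
  (PiLp.norm_apply_le (φ p) i).trans (hφ.2 p)

lemma IsTestField.continuous_apply (hφ : IsTestField φ) (i : Fin d) :
    Continuous fun p => φ p i :=
  (EuclideanSpace.proj (𝕜 := ℝ) i).continuous.comp hφ.continuous

lemma IsTestField.norm_sub_le (hφ : IsTestField φ) {i : Fin d} {C : ℝ}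
    (hC : ∀ p, ‖partialDeriv φ i p‖ ≤ C) (p : UnitAddTorus (Fin d)) {t : ℝ} (ht : 0 < t) :
    ‖(φ (p + shift i t) i - φ p i) / t‖ ≤ C := by
  have := Convex.norm_image_sub_le_of_norm_hasDerivWithin_le (s := Set.univ) (x := 0) (y := t)
    (f := fun t : ℝ => φ (p + shift i t) i)
    (fun s _ => (hφ.hasDerivAt i p s).hasDerivWithinAt) (fun s _ => hC _) convex_univ
    (Set.mem_univ _) (Set.mem_univ _)
  simp only [shift_zero, add_zero, sub_zero] at this
  rw [norm_div, div_le_iff₀ (by simpa using ht.ne')]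
  exact this

/-- Dominated convergence, with the dominating constant from the mean value inequality. It replaces
the divergence by translations, so no divergence theorem on cells is needed. -/
lemma IsTestField.tendsto_difference_quotient (hφ : IsTestField φ) (i : Fin d)
    (V : Set (UnitAddTorus (Fin d))) {t : ℕ → ℝ} (ht : ∀ k, 0 < t k)
    (ht0 : Tendsto t atTop (𝓝 0)) :
    Tendsto (fun k => ∫ p in V, (φ (p + shift i (t k)) i - φ p i) / t k) atTop
      (𝓝 (∫ p in V, partialDeriv φ i p)) := by
  obtain ⟨C, hC⟩ := hφ.exists_bound i
  refine tendsto_integral_of_dominated_convergence (fun _ => C) (fun k => ?_)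
    (integrable_const C) (fun k => ae_of_all _ fun p => hφ.norm_sub_le hC p (ht k))
    (ae_of_all _ fun p => ?_)
  · refine Continuous.aestronglyMeasurable ?_
    exact (((hφ.continuous_apply i).comp (continuous_id.add continuous_const)).sub
      (hφ.continuous_apply i)).div_const _
  · have h := hφ.hasDerivAt i p 0
    rw [shift_zero, add_zero, hasDerivAt_iff_tendsto_slope] at h
    have h' : Tendsto t atTop (𝓝[≠] 0) :=
      tendsto_nhdsWithin_iff.2 ⟨ht0, Eventually.of_forall fun k => (ht k).ne'⟩
    refine (h.comp h').congr fun k => ?_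
    simp [slope_def_field, shift_zero]

/-- Testing the difference quotients against an indicator costs at most the volume of the points
whose membership changes under the translation. -/
lemma IsTestField.integral_sub_le (hφ : IsTestField φ) (i : Fin d)
    {V : Set (UnitAddTorus (Fin d))} (hV : MeasurableSet V) (t : ℝ) :
    ∫ p in V, (φ (p + shift i t) i - φ p i) ≤
      volume.real {p | ¬ (p - shift i t ∈ V ↔ p ∈ V)} := by
  have hc := hφ.continuous_apply i
  have hint : ∀ f : UnitAddTorus (Fin d) → ℝ, Continuous f → Integrable f := fun f hf =>
    hf.integrable_of_hasCompactSupport (HasCompactSupport.of_compactSpace f)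
  have h1 := hint _ hc
  have h2 : Integrable fun p => φ (p + shift i t) i :=
    hint _ (hc.comp (continuous_id.add continuous_const))
  have hV' : MeasurableSet {p | p - shift i t ∈ V} :=
    measurable_id.sub_const _ hV
  have e1 : ∫ p in V, φ (p + shift i t) i =
      ∫ p, {p | p - shift i t ∈ V}.indicator (fun p => φ p i) p := by
    rw [← integral_indicator hV, ← integral_add_right_eq_self
      ({p | p - shift i t ∈ V}.indicator fun p => φ p i) (shift i t)]
    congr 1
    ext p
    have hiff : p + shift i t ∈ {p | p - shift i t ∈ V} ↔ p ∈ V := by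
      rw [Set.mem_ofPred_eq, add_sub_cancel_right]
    by_cases hp : p ∈ V
    · rw [Set.indicator_of_mem hp, Set.indicator_of_mem (hiff.2 hp)]
    · rw [Set.indicator_of_notMem hp, Set.indicator_of_notMem (mt hiff.1 hp)]
  have hW : MeasurableSet {p | ¬ (p - shift i t ∈ V ↔ p ∈ V)} := by
    have : {p | ¬ (p - shift i t ∈ V ↔ p ∈ V)} =
        ({p | p - shift i t ∈ V} \ V) ∪ (V \ {p | p - shift i t ∈ V}) := by
      ext p
      simp only [Set.mem_ofPred_eq, Set.mem_union, Set.mem_sdiff]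
      tauto
    rw [this]
    exact (hV'.diff hV).union (hV.diff hV')
  rw [integral_sub h2.integrableOn h1.integrableOn, e1, ← integral_indicator hV,
    ← integral_sub (h1.indicator hV') (h1.indicator hV), ← integral_indicator_one hW]
  refine integral_mono ((h1.indicator hV').sub (h1.indicator hV))
    ((integrable_const 1).indicator hW) fun p => ?_
  have hb := abs_le.1 (hφ.abs_apply_le i p)
  simp only [Set.indicator, Set.mem_ofPred_eq, Pi.one_apply]
  by_cases ha : p - shift i t ∈ V <;> by_cases hb' : p ∈ V <;> simp [ha, hb'] <;> linarith

-- A translation by at most one side length crosses at most one face in direction `i`. The affected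
-- points form a slab of thickness `t` at each face separating `B` from its complement.
open scoped Classical in
lemma volume_change_le {m : ℕ} (B : Finset (Lattice d m)) (i : Fin d) {t : ℝ} (ht : 0 < t)
    (ht1 : t * 2 ^ m ≤ 1) :
    volume.real {p : UnitAddTorus (Fin d) | ¬ (cell m (p - shift i t) ∈ B ↔ cell m p ∈ B)} ≤
      (Finset.univ.filter fun y : Lattice d m => ¬ (y - Pi.single i 1 ∈ B ↔ y ∈ B)).card *
        (t * (1 / 2 ^ m) ^ (d - 1)) := by
  set F := Finset.univ.filter fun y : Lattice d m => ¬ (y - Pi.single i 1 ∈ B ↔ y ∈ B)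
  have hsub : {p : UnitAddTorus (Fin d) | ¬ (cell m (p - shift i t) ∈ B ↔ cell m p ∈ B)} ⊆
      ⋃ y ∈ F, {p | cell m p = y ∧ circleCell (2 ^ m) (p i - t) ≠ y i} := by
    intro p hp
    have hother : ∀ j, j ≠ i → cell m (p - shift i t) j = cell m p j := by
      intro j hj
      simp [cell, shift, hj]
    have hi : cell m (p - shift i t) i = circleCell (2 ^ m) (p i - t) := by
      simp [cell, shift]
    rcases circleCell_sub (ℓ := 2 ^ m) ht (by exact_mod_cast ht1) (p i) with h | h
    · refine absurd ?_ hp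
      have : cell m (p - shift i t) = cell m p := by
        ext j
        by_cases hj : j = i
        · subst hj
          rw [hi, h]
          rfl
        · exact hother j hj
      rw [this]
    · have : cell m (p - shift i t) = cell m p - Pi.single i 1 := by
        ext j
        by_cases hj : j = i
        · subst hj
          rw [hi, h]
          simp [cell]
        · rw [hother j hj]
          simp [hj]
      simp only [Set.mem_iUnion]
      refine ⟨cell m p, ?_, rfl, fun heq => hp ?_⟩
      · rw [Set.mem_ofPred_eq, this] at hp
        exact Finset.mem_filter.2 ⟨Finset.mem_univ _, hp⟩
      · have : cell m (p - shift i t) = cell m p := by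
          ext j
          by_cases hj : j = i
          · subst hj
            rw [hi, heq]
          · exact hother j hj
        rw [this]
  refine ENNReal.toReal_le_of_le_ofReal (by positivity) ?_
  refine (measure_mono hsub).trans ((measure_biUnion_finset_le F _).trans ?_)
  rw [ENNReal.ofReal_mul (by positivity), ENNReal.ofReal_natCast, ← nsmul_eq_mul]
  refine Finset.sum_le_card_nsmul _ _ _ fun y _ => ?_
  have h : {p : UnitAddTorus (Fin d) | cell m p = y ∧ circleCell (2 ^ m) (p i - t) ≠ y i} ⊆
      Set.univ.pi fun j => if j = i then
        {θ : UnitAddCircle | circleCell (2 ^ m) θ = y i ∧ circleCell (2 ^ m) (θ - t) ≠ y i}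
        else {θ | circleCell (2 ^ m) θ = y j} := by
    rintro p ⟨hp, hp'⟩ j -
    subst hp
    dsimp only
    split_ifs with hj
    · subst hj
      exact ⟨rfl, hp'⟩
    · rfl
  refine (measure_mono h).trans ?_
  rw [volume_pi_pi, ← Finset.mul_prod_erase _ _ (Finset.mem_univ i), if_pos rfl,
    ENNReal.ofReal_mul ht.le, ENNReal.ofReal_pow (by positivity)]
  refine mul_le_mul' (volume_circleCell_change_le ht (y i)) ?_
  calc _ ≤ ∏ _j ∈ Finset.univ.erase i, ENNReal.ofReal (1 / 2 ^ m) := by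
        refine Finset.prod_le_prod' fun j hj => ?_
        rw [if_neg (Finset.ne_of_mem_erase hj)]
        simpa using volume_circleCell_le (y j)
    _ = _ := by simp

open scoped Classical in
/-- The perimeter of a union of cells is at most the total area of the faces where the labels of
the two adjacent cells differ. -/
lemma perimeter_cells_le {m : ℕ} (B : Finset (Lattice d m)) :
    perimeter {p : UnitAddTorus (Fin d) | cell m p ∈ B} ≤
      ENNReal.ofReal ((Finset.univ.filter fun e : Fin d × Lattice d m =>
        ¬ (e.2 + Pi.single e.1 1 ∈ B ↔ e.2 ∈ B)).card * (1 / 2 ^ m) ^ (d - 1)) := by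
  refine iSup₂_le fun φ hφ => ENNReal.ofReal_le_ofReal ?_
  set V : Set (UnitAddTorus (Fin d)) := {p | cell m p ∈ B} with hVdef
  have hV : MeasurableSet V := measurable_cell m B.measurableSet
  have hone : ∀ i, ∫ p in V, partialDeriv φ i p ≤
      (Finset.univ.filter fun y : Lattice d m => ¬ (y - Pi.single i 1 ∈ B ↔ y ∈ B)).card *
        (1 / 2 ^ m) ^ (d - 1) := by
    intro i
    let t : ℕ → ℝ := fun k => (1 / 2 ^ m) * (1 / ((k : ℝ) + 1))
    have ht : ∀ k, 0 < t k := fun k => by positivity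
    have ht0 : Tendsto t atTop (𝓝 0) := by
      have := tendsto_one_div_add_atTop_nhds_zero_nat.const_mul ((1 : ℝ) / 2 ^ m)
      rwa [mul_zero] at this
    have ht1 : ∀ k, t k * 2 ^ m ≤ 1 := by
      intro k
      have h1 : t k * 2 ^ m = 1 / ((k : ℝ) + 1) := by
        simp only [t]
        field_simp
      rw [h1, div_le_one (by positivity)]
      linarith [Nat.cast_nonneg (α := ℝ) k]
    refine le_of_tendsto (hφ.tendsto_difference_quotient i V ht ht0)
      (Eventually.of_forall fun k => ?_)
    rw [integral_div, div_le_iff₀ (ht k)]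
    refine (hφ.integral_sub_le i hV (t k)).trans ((volume_change_le B i (ht k) (ht1 k)).trans ?_)
    exact le_of_eq (by ring)
  have hint : ∀ i, Integrable (partialDeriv φ i) (volume.restrict V) := fun i =>
    ((hφ.continuous_partialDeriv i).integrable_of_hasCompactSupport
      (HasCompactSupport.of_compactSpace _)).integrableOn
  have hdiv : ∫ p in V, divergence φ p = ∑ i, ∫ p in V, partialDeriv φ i p :=
    integral_finsetSum _ fun i _ => hint i
  rw [hdiv]
  refine (Finset.sum_le_sum fun i _ => hone i).trans ?_
  rw [← Finset.sum_mul, ← Nat.cast_sum]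
  refine mul_le_mul_of_nonneg_right ?_ (by positivity)
  refine Nat.cast_le.2 (le_of_eq ?_)
  simp_rw [Finset.card_filter]
  rw [Fintype.sum_prod_type]
  refine Finset.sum_congr rfl fun i _ => ?_
  -- Index each face by the cell behind it instead of the cell in front of it.
  refine (Equiv.sum_comp (Equiv.addRight (Pi.single i 1 : Lattice d m)) _).symm.trans ?_
  refine Finset.sum_congr rfl fun y _ => ?_
  simp only [Equiv.coe_addRight, add_sub_cancel_right]
  congr 1
  exact propext (not_congr Iff.comm)

end Perimeter

/-! ### The zero set as a random finite set -/

section ZeroSet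

open scoped Classical

variable {d : ℕ}

/-- The finite set of sites whose box carries the label zero. -/
def zeros (m : ℕ) (w : UnitAddTorus (Fin d) → ℝ) : Finset (Lattice d m) :=
  Finset.univ.filter fun x => w (site x) = 0

lemma mem_zeros {m : ℕ} {w : UnitAddTorus (Fin d) → ℝ} {x : Lattice d m} :
    x ∈ zeros m w ↔ w (site x) = 0 := by
  simp [zeros]

lemma card_closedNbhd_starGraph_le {m : ℕ} (S : Finset (Lattice d m)) :
    (closedNbhd (starGraph d m) S).card ≤ 3 ^ d * S.card := by
  refine card_closedNbhd_le (fun x => ?_) S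
  refine ⟨Fintype.piFinset fun i => ({x i, x i + 1, x i - 1} : Finset (ZMod (2 ^ m))), ?_,
    fun y hy => Fintype.mem_piFinset.2 fun i => ?_⟩
  · rw [Fintype.card_piFinset]
    calc _ ≤ ∏ _i : Fin d, 3 := Finset.prod_le_prod' fun i _ => Finset.card_le_three
      _ = 3 ^ d := by simp
  · simp only [Finset.mem_insert, Finset.mem_singleton]
    rcases hy with rfl | hy
    · exact Or.inl rfl
    · rcases hy.2 i with h | h | h
      · exact Or.inl h
      · exact Or.inr (Or.inl h)
      · exact Or.inr (Or.inr (eq_sub_of_add_eq h.symm))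

lemma setBernoulli_superset {ι : Type*} (S : Finset ι) (r : unitInterval) :
    setBernoulli (Set.univ : Set ι) r {T | (S : Set ι) ⊆ T} = ENNReal.ofReal ((r : ℝ) ^ S.card) := by
  rw [setBernoulli_apply']
  have h : (fun p : ι → Prop => {i | p i}) ⁻¹' {T | (S : Set ι) ⊆ T} =
      Set.pi S fun _ => ({True} : Set Prop) := by
    ext p
    simp only [Set.mem_preimage, Set.mem_ofPred_eq, Set.subset_def, Finset.mem_coe, Set.mem_pi,
      Set.mem_singleton_iff, eq_iff_iff, iff_true]
  rw [h, Measure.infinitePi_pi _ fun _ _ => MeasurableSet.of_discrete]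
  have h1 : ∀ i ∈ S, (unitInterval.toNNReal r • Measure.dirac (i ∈ (Set.univ : Set ι)) +
      unitInterval.toNNReal (unitInterval.symm r) • Measure.dirac False) {True} =
        ENNReal.ofReal (r : ℝ) := by
    intro i _
    simp
    exact (ENNReal.ofReal_eq_coe_nnreal r.2.1).symm
  rw [Finset.prod_congr rfl h1, Finset.prod_const, ENNReal.ofReal_pow r.2.1]

variable {Ω : Type*} [MeasurableSpace Ω] {P : Measure Ω} {m : ℕ}
  {w : Ω → UnitAddTorus (Fin d) → ℝ}

lemma measurableSet_zeros_eq (hw : ∀ p, Measurable fun ω => w ω p) (A : Finset (Lattice d m)) :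
    MeasurableSet {ω | zeros m (w ω) = A} := by
  have h : {ω | zeros m (w ω) = A} = ⋂ x : Lattice d m, {ω | w ω (site x) = 0 ↔ x ∈ A} := by
    ext ω
    simp [Finset.ext_iff, mem_zeros]
  rw [h]
  refine MeasurableSet.iInter fun x => ?_
  have hm : MeasurableSet {ω | w ω (site x) = 0} := hw _ (measurableSet_singleton 0)
  by_cases hx : x ∈ A
  · simp only [hx, iff_true]
    exact hm
  · simp only [hx, iff_false]
    exact hm.compl

lemma sum_measure_zeros_eq [IsProbabilityMeasure P] (hw : ∀ p, Measurable fun ω => w ω p)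
    (Q : Finset (Lattice d m) → Prop) :
    ∑ A, (if Q A then P.real {ω | zeros m (w ω) = A} else 0) =
      P.real {ω | Q (zeros m (w ω))} := by
  rw [← Finset.sum_filter]
  have h : {ω | Q (zeros m (w ω))} =
      ⋃ A ∈ Finset.univ.filter Q, {ω | zeros m (w ω) = A} := by
    ext ω
    simp
  rw [h, measureReal_biUnion_finset _ fun A _ => measurableSet_zeros_eq hw A]
  intro A _ B _ hAB
  refine Set.disjoint_left.2 fun ω hA hB => hAB ?_
  exact hA.symm.trans hB

lemma measurable_zeroSet (hw : ∀ p, Measurable fun ω => w ω p) :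
    Measurable fun ω => zeroSet m (w ω) := by
  refine MeasurableEquiv.setOfPred.measurable.comp
    (measurable_pi_lambda _ fun x => ?_) (f := fun ω (x : Lattice d m) => w ω (site x) = 0)
  exact measurableSet_setOfPred.1 (hw _ (measurableSet_singleton 0))

/-- The sets containing `S` form an increasing family, to which the domination applies. -/
lemma measure_subset_zeros_le (hw : ∀ p, Measurable fun ω => w ω p) {r : unitInterval}
    (hA : AssumptionA P m r w) (S : Finset (Lattice d m)) :
    P.real {ω | S ⊆ zeros m (w ω)} ≤ (r : ℝ) ^ S.card := by
  refine ENNReal.toReal_le_of_le_ofReal (pow_nonneg r.2.1 _) ?_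
  rw [← setBernoulli_superset]
  have hU : MeasurableSet {T : Set (Lattice d m) | (S : Set (Lattice d m)) ⊆ T} :=
    MeasurableSet.of_discrete
  refine le_trans (le_of_eq ?_) (hA _ (fun T T' h hT => hT.trans h) hU)
  rw [Measure.map_apply (measurable_zeroSet hw) hU]
  congr 1
  ext ω
  simp [Set.subset_def, Finset.subset_iff, mem_zeros, zeroSet]

/-- The exponential tail bound for functionals of the clusters of zeros. -/
lemma zeros_tail_bound [IsProbabilityMeasure P] (hw : ∀ p, Measurable fun ω => w ω p) {r : unitInterval}
    (hA : AssumptionA P m r w) {f : Finset (Lattice d m) → ℝ} (hf : ∀ S, 0 ≤ f S) {τ : ℝ}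
    (hτ : 0 < τ) {M : ℝ} (hMτ : ((2 : ℝ) ^ m) ^ d * M ≤ τ / 9)
    (hM : ∀ S : Finset (Lattice d m), S.Nonempty →
      (Real.exp (f S) - 1) * (2 ^ 3 ^ d * (r : ℝ)) ^ S.card ≤ M) :
    P.real {ω | τ ≤ ∑ S ∈ clusters (starGraph d m) (zeros m (w ω)), f S} ≤
      1 / 3 * Real.exp (-(τ / 4)) := by
  rw [← sum_measure_zeros_eq hw fun A => τ ≤ ∑ S ∈ clusters (starGraph d m) A, f S]
  refine cluster_tail_bound (r := r) (fun A => measureReal_nonneg) ?_ (fun S => ?_) r.2.1 hf hτ ?_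
  · have := sum_measure_zeros_eq (P := P) (m := m) hw fun _ => True
    simpa using this
  · refine le_trans (le_of_eq ?_) (measure_subset_zeros_le hw hA S)
    rw [← sum_measure_zeros_eq hw fun A => S ⊆ A]
    exact Finset.sum_congr rfl fun A _ => by congr
  · refine (sum_animals_le (D := 3 ^ d) card_closedNbhd_starGraph_le (M := M) (fun S => ?_)
      fun S hS => ?_).trans ?_
    · have := Real.one_le_exp (hf S)
      exact mul_nonneg (by linarith) (pow_nonneg r.2.1 _)
    · refine le_trans (le_of_eq ?_) (hM S hS)
      rw [mul_pow, ← pow_mul]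
      ring
    · refine le_trans (le_of_eq ?_) hMτ
      simp [Lattice, ZMod.card]

end ZeroSet

/-! ### Reconstruction of the phases -/

section Reconstruction

open scoped Classical

variable {d : ℕ}

lemma mem_of_mem_support_openGraph {V : Type*} [Fintype V] {G : SimpleGraph V} {A : Finset V}
    {x y : V} (c : (openGraph G A).Walk x y) (hx : x ∈ A) : ∀ z ∈ c.support, z ∈ A := by
  induction c with
  | nil => simpa using hx
  | cons h c ih =>
    intro z hz
    rw [SimpleGraph.Walk.support_cons, List.mem_cons] at hz
    rcases hz with rfl | hz
    · exact hx
    · exact ih h.2.2 z hz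

lemma mem_of_reachable_openGraph {V : Type*} [Fintype V] {G : SimpleGraph V} {A : Finset V}
    {x y : V} (h : (openGraph G A).Reachable x y) (hxy : x ≠ y) : x ∈ A := by
  obtain ⟨c⟩ := h
  cases c with
  | nil => exact absurd rfl hxy
  | cons h _ => exact h.2.1

lemma openGraph_le {V : Type*} [Fintype V] (G : SimpleGraph V) (A : Finset V) :
    openGraph G A ≤ G := fun _ _ (h : G.Adj _ _ ∧ _) => h.1

/-- The labels at scale `k` extend to a sign field on the finer scale `κ` which is constant across
the edges that avoid the zeros at scale `κ`. -/
lemma exists_sign_field {n κ k : ℕ} {u : ℕ → UnitAddTorus (Fin d) → ℝ} (hκ : 1 ≤ κ) (hκk : κ < k)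
    (hkn : k ≤ n) (huk : IsPhaseLabel (n - k) (u k)) (hB : AssumptionB n u k) :
    ∃ s : Lattice d (n - κ) → ZMod 2,
      (∀ x y, (starGraph d (n - κ)).Adj x y → x ∉ zeros (n - κ) (u κ) → y ∉ zeros (n - κ) (u κ) →
        s x = s y) ∧
      ∀ p, u k p ≠ 0 → u k p = if s (cell (n - κ) p) = 0 then 1 else -1 := by
  set A : Finset (Lattice d (n - κ)) := (zeros (n - κ) (u κ))ᶜ with hAdef
  set H := openGraph (starGraph d (n - κ)) A with hH
  -- Zero-free components are declared negative when they meet a negative `k`-block; assumption B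
  -- says that such a component meets no positive one.
  let Q : Lattice d (n - κ) → Prop := fun y => ∃ z, H.Reachable y z ∧ u k (site z) = -1
  refine ⟨fun y => if Q y then 1 else 0, fun x y hxy hx hy => ?_, fun p hp => ?_⟩
  · have hr : H.Reachable x y := SimpleGraph.Adj.reachable
      (show H.Adj x y from ⟨hxy, Finset.mem_compl.2 hx, Finset.mem_compl.2 hy⟩)
    have : Q x ↔ Q y := ⟨fun ⟨z, hz, h⟩ => ⟨z, hr.symm.trans hz, h⟩,
      fun ⟨z, hz, h⟩ => ⟨z, hr.trans hz, h⟩⟩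
    simp only [this]
  · have hcell := huk.eq_site_cell (show n - k < n - κ by omega) p
    rcases huk.1 p with h | h | h
    · have hQ : ¬ Q (cell (n - κ) p) := by
        rintro ⟨z, hz, hzk⟩
        rw [hcell] at h
        -- A trivial walk may sit on a zero. A nontrivial one starts, and hence stays, outside the
        -- zeros.
        have hne : cell (n - κ) p ≠ z := by
          rintro rfl
          rw [h] at hzk
          norm_num at hzk
        have hmem := mem_of_reachable_openGraph hz hne
        obtain ⟨c⟩ := hz
        have hprod : u k (site (boxIndex (n - k) (site (cell (n - κ) p)))) *
            u k (site (boxIndex (n - k) (site z))) = -1 := by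
          rw [← huk.eq_site_boxIndex, ← huk.eq_site_boxIndex, h, hzk]
          norm_num
        obtain ⟨y, hy, hy0⟩ := hB _ _ hprod κ hκ hκk.le _ _ (mem_box_boxIndex _ _)
          (mem_box_boxIndex _ _) (c.mapLe (openGraph_le _ A))
        rw [SimpleGraph.Walk.support_mapLe_eq_support] at hy
        have := mem_of_mem_support_openGraph c hmem y hy
        rw [hAdef, Finset.mem_compl, mem_zeros] at this
        exact this hy0
      simp only [h, if_neg hQ, if_true]
    · have hQ : Q (cell (n - κ) p) := ⟨_, SimpleGraph.Reachable.refl _, hcell ▸ h⟩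
      simp only [h, if_pos hQ, if_neg one_ne_zero]
    · exact absurd h hp

/-- A sufficient condition for a label to be close to a phase configuration that is constant on
cells. -/
lemma mem_nbhd_of_cells {m M : ℕ} {w : UnitAddTorus (Fin d) → ℝ} (hw : IsPhaseLabel m w)
    {s v : Lattice d M → ZMod 2}
    (hs : ∀ p, w p ≠ 0 → w p = if s (cell M p) = 0 then 1 else -1) {a δ : ℝ}
    (h0 : ((zeros m w).card : ℝ) ≤ δ * (2 ^ m) ^ d)
    (h1 : ((Finset.univ.filter fun x => v x ≠ s x).card : ℝ) ≤ δ / 2 * (2 ^ M) ^ d)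
    (h2 : ((Finset.univ.filter fun e : Fin d × Lattice d M =>
      v (e.2 + Pi.single e.1 1) ≠ v e.2).card : ℝ) ≤ a * (2 ^ M) ^ (d - 1)) :
    w ∈ nbhd (perimeterBall d a) (2 * δ) := by
  set σ : UnitAddTorus (Fin d) → ℝ := fun p => if v (cell M p) = 0 then 1 else -1 with hσ
  have hσm : Measurable σ :=
    (measurable_of_countable fun y : Lattice d M => if v y = 0 then (1 : ℝ) else -1).comp
      (measurable_cell M)
  have hσ1 : ∀ p, σ p = 1 ∨ σ p = -1 := fun p => by
    simp only [hσ]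
    split_ifs <;> simp
  have hV : {p | σ p = 1} = {p | cell M p ∈ Finset.univ.filter fun y => v y = 0} := by
    ext p
    simp only [hσ, Set.mem_ofPred_eq, Finset.mem_filter, Finset.mem_univ, true_and]
    split_ifs with h
    · simp [h]
    · simp only [h, iff_false]
      norm_num
  have hper : perimeter {p | σ p = 1} ≤ ENNReal.ofReal a := by
    rw [hV]
    refine (perimeter_cells_le _).trans (ENNReal.ofReal_le_ofReal ?_)
    have hcard : ((Finset.univ.filter fun e : Fin d × Lattice d M =>
        ¬ (e.2 + Pi.single e.1 1 ∈ (Finset.univ.filter fun y => v y = 0) ↔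
          e.2 ∈ Finset.univ.filter fun y => v y = 0)).card : ℝ) ≤ a * (2 ^ M) ^ (d - 1) := by
      refine le_trans (Nat.cast_le.2 (Finset.card_le_card fun e he => ?_)) h2
      simp only [Finset.mem_filter, Finset.mem_univ, true_and] at he ⊢
      intro h
      rw [h] at he
      exact he Iff.rfl
    refine (mul_le_mul_of_nonneg_right hcard (by positivity)).trans (le_of_eq ?_)
    rw [mul_assoc, ← mul_pow, mul_one_div_cancel (by positivity), one_pow, mul_one]
  have hbdd : ∀ f : UnitAddTorus (Fin d) → ℝ, Measurable f → (∀ p, ‖f p‖ ≤ 1) → Integrable f :=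
    fun f hf hb => (integrable_const (1 : ℝ)).mono' hf.aestronglyMeasurable (ae_of_all _ hb)
  have hwm := hw.measurable
  have hwi : Integrable w := hbdd w hwm fun p => by
    rcases hw.1 p with h | h | h <;> simp [h]
  have hσi : Integrable σ := hbdd σ hσm fun p => by
    rcases hσ1 p with h | h <;> simp [h]
  refine ⟨hwi, σ, ⟨⟨hσm, hσ1, hper.trans_lt ENNReal.ofReal_lt_top⟩, hper⟩, ?_⟩
  set E₀ : Set (UnitAddTorus (Fin d)) := {p | boxIndex m p ∈ zeros m w} with hE₀
  set E₁ : Set (UnitAddTorus (Fin d)) :=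
    {p | cell M p ∈ Finset.univ.filter fun x => v x ≠ s x} with hE₁
  have hE₀m : MeasurableSet E₀ := measurable_boxIndex m (Finset.measurableSet _)
  have hE₁m : MeasurableSet E₁ := measurable_cell M (Finset.measurableSet _)
  have hi₀ : Integrable (E₀.indicator (1 : UnitAddTorus (Fin d) → ℝ)) :=
    (integrable_const (1 : ℝ)).indicator hE₀m
  have hi₁ : Integrable (E₁.indicator (1 : UnitAddTorus (Fin d) → ℝ)) :=
    (integrable_const (1 : ℝ)).indicator hE₁m
  have hv₀ := volume_index_mem_le (f := boxIndex m) (volume_boxIndex_le m) (zeros m w)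
  have hv₁ := volume_index_mem_le (f := cell M) (volume_cell_le (d := d) M)
    (Finset.univ.filter fun x => v x ≠ s x)
  calc ∫ p, |w p - σ p|
      ≤ ∫ p, (E₀.indicator (1 : UnitAddTorus (Fin d) → ℝ) p +
          2 * E₁.indicator (1 : UnitAddTorus (Fin d) → ℝ) p) := by
        -- A zero label is at distance `1` from either sign, a wrong sign at distance `2`.
        refine integral_mono (hwi.sub hσi).abs (hi₀.add (hi₁.const_mul 2)) fun p => ?_
        have hn₁ : 0 ≤ E₁.indicator (1 : UnitAddTorus (Fin d) → ℝ) p :=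
          Set.indicator_nonneg (fun _ _ => zero_le_one) p
        have hn₀ : 0 ≤ E₀.indicator (1 : UnitAddTorus (Fin d) → ℝ) p :=
          Set.indicator_nonneg (fun _ _ => zero_le_one) p
        simp only
        by_cases hp : w p = 0
        · have hmem : p ∈ E₀ := by
            rw [hE₀, Set.mem_ofPred_eq, mem_zeros, ← hw.eq_site_boxIndex]
            exact hp
          rw [Set.indicator_of_mem hmem, hp, zero_sub, abs_neg, Pi.one_apply]
          rcases hσ1 p with h | h <;> rw [h] <;> simp <;> linarith
        · by_cases hvs : v (cell M p) = s (cell M p)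
          · have : w p = σ p := by
              rw [hs p hp, hσ]
              simp only [hvs]
            rw [this, sub_self, abs_zero]
            linarith
          · have hmem : p ∈ E₁ := by
              rw [hE₁, Set.mem_ofPred_eq]
              simpa using hvs
            rw [Set.indicator_of_mem hmem, Pi.one_apply]
            have : |w p - σ p| ≤ 2 := by
              rcases hw.1 p with h | h | h <;> rcases hσ1 p with h' | h' <;> rw [h, h'] <;>
                norm_num [abs_le]
            linarith
    _ = volume.real E₀ + 2 * volume.real E₁ := by
        rw [integral_add hi₀ (hi₁.const_mul 2), integral_const_mul, integral_indicator_one hE₀m,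
          integral_indicator_one hE₁m]
    _ ≤ δ + 2 * (δ / 2) := by
        refine add_le_add (hv₀.trans ?_) (mul_le_mul_of_nonneg_left (hv₁.trans ?_) zero_le_two)
        · refine (mul_le_mul_of_nonneg_right h0 (by positivity)).trans (le_of_eq ?_)
          rw [mul_assoc, ← mul_pow, mul_one_div_cancel (by positivity), one_pow, mul_one]
        · refine (mul_le_mul_of_nonneg_right h1 (by positivity)).trans (le_of_eq ?_)
          rw [mul_assoc, ← mul_pow, mul_one_div_cancel (by positivity), one_pow, mul_one]
    _ = 2 * δ := by ring

/-- If there are few zeros at scale `k` and both the large and the small clusters of zeros at the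
finer scale `κ` are under control, then the labels at scale `k` are close to the perimeter ball. -/
lemma mem_nbhd_of_clusters {n κ k : ℕ} {u : ℕ → UnitAddTorus (Fin d) → ℝ} (hd : 2 ≤ d)
    (hκ : 1 ≤ κ) (hκk : κ < k) (hkn : k ≤ n) (huk : IsPhaseLabel (n - k) (u k))
    (hB : AssumptionB n u k) {a δ : ℝ} (hδ : δ < 1)
    (h0 : ((zeros (n - k) (u k)).card : ℝ) ≤ δ * (2 ^ (n - k)) ^ d)
    (h1 : ∑ S ∈ clusters (starGraph d (n - κ)) (zeros (n - κ) (u κ)),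
      (if S.card ≤ n then (S.card : ℝ) ^ d else 0) ≤ δ / 2 * (2 ^ (n - κ)) ^ d)
    (h2 : ∑ S ∈ clusters (starGraph d (n - κ)) (zeros (n - κ) (u κ)),
      (if S.card ≤ n then (0 : ℝ) else S.card) ≤ a * (2 ^ (n - κ)) ^ (d - 1) / (2 * d)) :
    u k ∈ nbhd (perimeterBall d a) (2 * δ) := by
  obtain ⟨s, hs, hsk⟩ := exists_sign_field hκ hκk hkn huk hB
  have hd0 : (0 : ℝ) < 2 * d := by
    have : 0 < d := by omega
    positivity
  -- A small cluster of size at least the side length would alone contribute the volume of the whole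
  -- lattice, more than the allowed fraction `δ / 2`.
  have hsmall : ∀ S ∈ clusters (starGraph d (n - κ)) (zeros (n - κ) (u κ)), S.card ≤ n →
      S.card < 2 ^ (n - κ) := by
    intro S hS hSn
    by_contra hcon
    push Not at hcon
    have h3 : (S.card : ℝ) ^ d ≤ ∑ S ∈ clusters (starGraph d (n - κ)) (zeros (n - κ) (u κ)),
        (if S.card ≤ n then (S.card : ℝ) ^ d else 0) := by
      have := Finset.single_le_sum (f := fun S : Finset (Lattice d (n - κ)) =>
        if S.card ≤ n then (S.card : ℝ) ^ d else 0) (fun T _ => by split_ifs <;> positivity) hS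
      simpa only [if_pos hSn] using this
    have h4 : ((2 : ℝ) ^ (n - κ)) ^ d ≤ (S.card : ℝ) ^ d :=
      pow_le_pow_left₀ (by positivity) (by exact_mod_cast hcon) d
    have h5 : (0 : ℝ) < (2 ^ (n - κ)) ^ d := by positivity
    nlinarith
  obtain ⟨v, hv1, hv2⟩ := exists_filling (n := n) hd hs hsmall
  refine mem_nbhd_of_cells huk hsk h0 (v := v) ?_ ?_
  · refine le_trans (Nat.cast_le.2 hv1) (le_trans (le_of_eq ?_) h1)
    push_cast
    rfl
  · refine le_trans (Nat.cast_le.2 hv2) ?_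
    rw [le_div_iff₀ hd0] at h2
    refine le_trans (le_of_eq ?_) h2
    push_cast
    rw [mul_comm]

/-- For `δ ≥ 1` every label is close to a constant phase. -/
lemma mem_nbhd_of_one_le {m : ℕ} {w : UnitAddTorus (Fin d) → ℝ} (hw : IsPhaseLabel m w)
    {a δ : ℝ} (hδ : 1 ≤ δ) : w ∈ nbhd (perimeterBall d a) (2 * δ) := by
  have hbdd : ∀ p, ‖w p‖ ≤ 1 := fun p => by
    rcases hw.1 p with h | h | h <;> simp [h]
  have hwi : Integrable w :=
    (integrable_const (1 : ℝ)).mono' hw.measurable.aestronglyMeasurable (ae_of_all _ hbdd)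
  have hper : perimeter {p : UnitAddTorus (Fin d) | (1 : ℝ) = 1} ≤ 0 := by
    have := perimeter_cells_le (d := d) (m := 0) Finset.univ
    simpa using this
  refine ⟨hwi, fun _ => 1, ⟨⟨measurable_const, fun _ => Or.inl rfl,
    hper.trans_lt ENNReal.zero_lt_top⟩, hper.trans zero_le⟩, ?_⟩
  calc ∫ p, |w p - 1| ≤ ∫ _p : UnitAddTorus (Fin d), (2 : ℝ) := by
        refine integral_mono (hwi.sub (integrable_const 1)).abs (integrable_const 2) fun p => ?_
        rcases hw.1 p with h | h | h <;> simp only [h] <;> norm_num [abs_le]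
    _ = 2 := by
        have : volume (Set.univ : Set (UnitAddTorus (Fin d))) = 1 := by
          rw [← Set.pi_univ Set.univ, volume_pi_pi]
          simp [AddCircle.measure_univ]
        simp [measureReal_def, this]
    _ ≤ 2 * δ := by linarith

end Reconstruction

/-! ### The three unlikely events -/

section Events

variable {d : ℕ} {Ω : Type*} [MeasurableSpace Ω] {P : Measure Ω} [IsProbabilityMeasure P] {m : ℕ}
  {w : Ω → UnitAddTorus (Fin d) → ℝ} {r : unitInterval}

/-- The small parameter of the cluster expansion. -/
def activity (d : ℕ) (r : unitInterval) : ℝ := Real.exp 1 * (2 ^ 3 ^ d * (r : ℝ))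

/-- In `activity`, the factor `exp 1` pays for the exponential moment of `|S|`, and `2 ^ 3 ^ d` for
the number of connected sets, both per site. -/
lemma activity_nonneg : 0 ≤ activity d r := by
  have := r.2.1
  unfold activity
  positivity

lemma exp_mul_pow_eq (j : ℕ) :
    Real.exp j * (2 ^ 3 ^ d * (r : ℝ)) ^ j = activity d r ^ j := by
  rw [activity, mul_pow (Real.exp 1), ← Real.exp_nat_mul, mul_one]

lemma rate_nonneg : 0 ≤ 2 ^ 3 ^ d * (r : ℝ) := by
  have := r.2.1
  positivity

/-- A positive density of zeros is unlikely. -/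
lemma card_zeros_tail (hw : ∀ p, Measurable fun ω => w ω p) (hA : AssumptionA P m r w) {δ : ℝ}
    (hδ : 0 < δ) (hδ1 : δ < 1) (hx : activity d r ≤ δ / 9) :
    P.real {ω | δ * (2 ^ m) ^ d ≤ ((zeros m (w ω)).card : ℝ)} ≤
      1 / 3 * Real.exp (-(δ * (2 ^ m) ^ d / 4)) := by
  have h := zeros_tail_bound hw hA (f := fun S => (S.card : ℝ)) (fun S => by positivity)
    (τ := δ * (2 ^ m) ^ d) (by positivity) (M := activity d r) ?_ fun S hS => ?_
  · simp_rw [← Nat.cast_sum, sum_card_clusters] at h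
    exact h
  · have : (0 : ℝ) ≤ (2 ^ m) ^ d := by positivity
    nlinarith
  · have h1 : (Real.exp S.card - 1) * (2 ^ 3 ^ d * (r : ℝ)) ^ S.card ≤ activity d r ^ S.card := by
      rw [← exp_mul_pow_eq]
      exact mul_le_mul_of_nonneg_right (by linarith) (pow_nonneg rate_nonneg _)
    exact h1.trans (pow_le_of_le_one activity_nonneg (by linarith) hS.card_pos.ne')

/-- A large total size of the clusters with more than `n` sites is unlikely. -/
lemma large_clusters_tail (hw : ∀ p, Measurable fun ω => w ω p) (hA : AssumptionA P m r w) {n : ℕ}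
    (hn : 1 ≤ n) (hmn : m ≤ n) (hx : activity d r ≤ 1 / (9 * 2 ^ d)) {τ : ℝ} (hτ : 1 ≤ τ) :
    P.real {ω | τ ≤ ∑ S ∈ clusters (starGraph d m) (zeros m (w ω)),
        (if S.card ≤ n then (0 : ℝ) else S.card)} ≤ 1 / 3 * Real.exp (-(τ / 4)) := by
  have hx2 : 2 ^ d * activity d r ≤ 1 / 9 := by
    rw [le_div_iff₀ (by positivity)] at hx
    linarith
  have hx0 : 0 ≤ activity d r := activity_nonneg
  have h2d : (1 : ℝ) ≤ 2 ^ d := one_le_pow₀ (by norm_num)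
  have hx1 : activity d r ≤ 1 := by nlinarith
  refine zeros_tail_bound hw hA (fun S => by split_ifs <;> positivity) (by linarith)
    (M := activity d r ^ n) ?_ fun S hS => ?_
  -- The cutoff at work: the weight of a cluster with more than `n` sites absorbs the `2^{dm}`
  -- possible positions.
  · calc ((2 : ℝ) ^ m) ^ d * activity d r ^ n ≤ (2 ^ n) ^ d * activity d r ^ n := by
          refine mul_le_mul_of_nonneg_right ?_ (by positivity)
          exact pow_le_pow_left₀ (by positivity) (pow_le_pow_right₀ (by norm_num) hmn) d
      _ = (2 ^ d * activity d r) ^ n := by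
          rw [mul_pow, ← pow_mul, ← pow_mul, mul_comm n d]
      _ ≤ 2 ^ d * activity d r := pow_le_of_le_one (by positivity) (by linarith) (by omega)
      _ ≤ τ / 9 := by linarith
  · split_ifs with hS'
    · simp only [Real.exp_zero, sub_self, zero_mul]
      positivity
    · have h1 : (Real.exp S.card - 1) * (2 ^ 3 ^ d * (r : ℝ)) ^ S.card ≤
          activity d r ^ S.card := by
        rw [← exp_mul_pow_eq]
        exact mul_le_mul_of_nonneg_right (by linarith) (pow_nonneg rate_nonneg _)
      exact h1.trans (pow_le_pow_of_le_one hx0 hx1 (by omega))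

/-- A large total volume of the clusters with at most `n` sites is unlikely. -/
lemma small_clusters_tail (hw : ∀ p, Measurable fun ω => w ω p) (hA : AssumptionA P m r w) {n : ℕ}
    (hn : 1 ≤ n) {δ : ℝ} (hδ : 0 < δ) (hδ1 : δ < 1)
    (hx : activity d r ≤ δ / (36 * d.factorial)) :
    P.real {ω | δ / 2 * (2 ^ m) ^ d ≤ ∑ S ∈ clusters (starGraph d m) (zeros m (w ω)),
        (if S.card ≤ n then (S.card : ℝ) ^ d else 0)} ≤
      1 / 3 * Real.exp (-(δ / 2 * (2 ^ m) ^ d / (n : ℝ) ^ d / 4)) := by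
  have hn0 : (0 : ℝ) < (n : ℝ) ^ d := by
    have : (0 : ℝ) < n := by exact_mod_cast hn
    positivity
  have hfac : (1 : ℝ) ≤ d.factorial := by exact_mod_cast d.factorial_pos
  have hx0 : 0 ≤ activity d r := activity_nonneg
  have hx2 : d.factorial * activity d r ≤ δ / 36 := by
    rw [le_div_iff₀ (by positivity)] at hx
    linarith
  have hx1 : activity d r ≤ 1 := by nlinarith
  have h := zeros_tail_bound hw hA
    (f := fun S => (if S.card ≤ n then (S.card : ℝ) ^ d else 0) / (n : ℝ) ^ d)
    (fun S => by split_ifs <;> positivity)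
    (τ := δ / 2 * (2 ^ m) ^ d / (n : ℝ) ^ d) (by positivity)
    (M := 2 * (d.factorial * activity d r) / (n : ℝ) ^ d) ?_ fun S hS => ?_
  · simp_rw [← Finset.sum_div, div_le_div_iff_of_pos_right hn0] at h
    exact h
  · have h1 : (0 : ℝ) ≤ (2 ^ m) ^ d := by positivity
    rw [← mul_div_assoc, div_div, mul_comm _ (9 : ℝ), ← div_div,
      div_le_div_iff_of_pos_right hn0]
    nlinarith
  · split_ifs with hS'
    · set f : ℝ := (S.card : ℝ) ^ d / (n : ℝ) ^ d with hf
      have hf0 : 0 ≤ f := by positivity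
      have hf1 : f ≤ 1 := by
        rw [hf, div_le_one hn0]
        exact pow_le_pow_left₀ (by positivity) (by exact_mod_cast hS') d
      have hexp : Real.exp f - 1 ≤ 2 * f := by
        have := (abs_le.1 (Real.abs_exp_sub_one_sub_id_le (abs_le.2 ⟨by linarith, hf1⟩))).2
        nlinarith
      have hpow : (S.card : ℝ) ^ d ≤ d.factorial * Real.exp S.card := by
        have := Real.pow_div_factorial_le_exp (S.card : ℝ) (by positivity) d
        rw [div_le_iff₀ (by positivity)] at this
        linarith
      have hq : 0 ≤ (2 ^ 3 ^ d * (r : ℝ)) ^ S.card := pow_nonneg rate_nonneg _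
      calc (Real.exp f - 1) * (2 ^ 3 ^ d * (r : ℝ)) ^ S.card
          ≤ 2 * f * (2 ^ 3 ^ d * (r : ℝ)) ^ S.card := mul_le_mul_of_nonneg_right hexp hq
        _ = 2 * ((S.card : ℝ) ^ d * (2 ^ 3 ^ d * (r : ℝ)) ^ S.card) / (n : ℝ) ^ d := by
            rw [hf]
            ring
        _ ≤ 2 * (d.factorial * activity d r) / (n : ℝ) ^ d := by
            refine div_le_div_of_nonneg_right ?_ hn0.le
            refine mul_le_mul_of_nonneg_left ?_ zero_le_two
            calc (S.card : ℝ) ^ d * (2 ^ 3 ^ d * (r : ℝ)) ^ S.card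
                ≤ d.factorial * Real.exp S.card * (2 ^ 3 ^ d * (r : ℝ)) ^ S.card :=
                  mul_le_mul_of_nonneg_right hpow hq
              _ = d.factorial * activity d r ^ S.card := by rw [mul_assoc, exp_mul_pow_eq]
              _ ≤ d.factorial * activity d r := by
                  refine mul_le_mul_of_nonneg_left ?_ (by positivity)
                  exact pow_le_of_le_one hx0 hx1 hS.card_pos.ne'
    · simp only [zero_div, Real.exp_zero, sub_self, zero_mul]
      positivity

end Events

/-! ### Assembling the probability bound -/

/-- Up to `δ` and the power of `n`, the rates in the theorem are numbers of sites at scale `j`; `n -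
d * j` may be negative, hence the integer power. -/
lemma pow_mul_zpow_eq {d n j : ℕ} (hd : 1 ≤ d) (hj : j ≤ n) :
    ((2 : ℝ) ^ n) ^ (d - 1) * (2 : ℝ) ^ ((n : ℤ) - d * j) = (2 ^ (n - j)) ^ d := by
  have h1 : (2 : ℝ) ^ ((n : ℤ) - d * j) = 2 ^ n / (2 ^ j) ^ d := by
    rw [zpow_sub₀ two_ne_zero, zpow_natCast, ← pow_mul, mul_comm j d]
    norm_cast
  have h2 : ((2 : ℝ) ^ n) ^ (d - 1) * 2 ^ n = (2 ^ n) ^ d := by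
    rw [← pow_succ, Nat.sub_add_cancel hd]
  rw [h1, ← mul_div_assoc, h2, ← div_pow, pow_sub₀ _ two_ne_zero hj, div_eq_mul_inv]

/-- The probability estimate, given smallness of the densities at the scales `κ` and `k`. -/
lemma measure_notMem_nbhd_le {d n κ k : ℕ} (hd : 2 ≤ d) {Ω : Type*} [MeasurableSpace Ω]
    {P : Measure Ω} [IsProbabilityMeasure P] {u : ℕ → Ω → UnitAddTorus (Fin d) → ℝ}
    {ρ : ℕ → unitInterval} (hκ : 1 ≤ κ) (hκk : κ < k) (hkn : k ≤ n)
    (hlabel : ∀ ω, IsPhaseLabel (n - k) (u k ω))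
    (huk : ∀ p, Measurable fun ω => u k ω p) (huκ : ∀ p, Measurable fun ω => u κ ω p)
    (hAk : AssumptionA P (n - k) (ρ k) (u k)) (hAκ : AssumptionA P (n - κ) (ρ κ) (u κ))
    (hB : ∀ᵐ ω ∂P, AssumptionB n (fun j => u j ω) k) {a δ : ℝ} (ha : 0 < a) (hδ : 0 < δ)
    (hδ1 : δ < 1) (hxk : activity d (ρ k) ≤ δ / 9)
    (hxκ : activity d (ρ κ) ≤ min (1 / (9 * 2 ^ d)) (δ / (36 * d.factorial))) :
    P.real {ω | u k ω ∉ nbhd (perimeterBall d a) (2 * δ)} ≤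
      1 / 3 * Real.exp (-(δ * (2 ^ (n - k)) ^ d / 4)) +
      1 / 3 * Real.exp (-(max 1 (a * (2 ^ (n - κ)) ^ (d - 1) / (2 * d)) / 4)) +
      1 / 3 * Real.exp (-(δ / 2 * (2 ^ (n - κ)) ^ d / (n : ℝ) ^ d / 4)) := by
  have hn : 1 ≤ n := by omega
  have hn0 : (0 : ℝ) < n := by exact_mod_cast hn
  set E₁ := {ω | δ * (2 ^ (n - k)) ^ d ≤ ((zeros (n - k) (u k ω)).card : ℝ)} with hE₁
  set E₂ := {ω | max 1 (a * (2 ^ (n - κ)) ^ (d - 1) / (2 * d)) ≤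
    ∑ S ∈ clusters (starGraph d (n - κ)) (zeros (n - κ) (u κ ω)),
      (if S.card ≤ n then (0 : ℝ) else S.card)} with hE₂
  set E₃ := {ω | δ / 2 * (2 ^ (n - κ)) ^ d ≤
    ∑ S ∈ clusters (starGraph d (n - κ)) (zeros (n - κ) (u κ ω)),
      (if S.card ≤ n then (S.card : ℝ) ^ d else 0)} with hE₃
  set N := {ω | ¬ AssumptionB n (fun j => u j ω) k} with hN
  have hN0 : P.real N = 0 := by
    rw [measureReal_def, ae_iff.1 hB, ENNReal.toReal_zero]
  have hsub : {ω | u k ω ∉ nbhd (perimeterBall d a) (2 * δ)} ⊆ ((E₁ ∪ E₂) ∪ E₃) ∪ N := by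
    intro ω hω
    by_contra hcon
    simp only [Set.mem_union, not_or, hE₁, hE₂, hE₃, hN, Set.mem_ofPred_eq, not_le, not_not]
      at hcon
    obtain ⟨⟨⟨h1, h2⟩, h3⟩, h4⟩ := hcon
    refine hω (mem_nbhd_of_clusters (u := fun j => u j ω) hd hκ hκk hkn (hlabel ω) h4 hδ1 h1.le
      h3.le ?_)
    -- The tail bound needs a threshold of at least `1`. This loses nothing: a total size below `1`
    -- is an integer, so there are no large clusters at all.
    rcases lt_max_iff.1 h2 with h | h
    · have hcast : ∑ S ∈ clusters (starGraph d (n - κ)) (zeros (n - κ) (u κ ω)),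
          (if S.card ≤ n then (0 : ℝ) else S.card) =
          ((∑ S ∈ clusters (starGraph d (n - κ)) (zeros (n - κ) (u κ ω)),
            (if S.card ≤ n then 0 else S.card) : ℕ) : ℝ) := by
        push_cast
        rfl
      rw [hcast] at h ⊢
      have h0 := Nat.lt_one_iff.1 (by exact_mod_cast h)
      rw [h0, Nat.cast_zero]
      positivity
    · exact h.le
  refine (measureReal_mono hsub).trans ?_
  refine (measureReal_union_le _ _).trans ?_
  rw [hN0, add_zero]
  refine (measureReal_union_le _ _).trans (add_le_add ((measureReal_union_le _ _).trans
    (add_le_add ?_ ?_)) ?_)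
  · exact card_zeros_tail huk hAk hδ hδ1 hxk
  · exact large_clusters_tail huκ hAκ hn (Nat.sub_le _ _) (hxκ.trans (min_le_left _ _))
      (le_max_left _ _)
  · exact small_clusters_tail huκ hAκ hn hδ hδ1 (hxκ.trans (min_le_right _ _))

end PhaseLabels

end

theorem mainTheorem3 (d : ℕ) (hd : 2 ≤ d) :
    ∃ c₁ : ℝ, 0 < c₁ ∧
      ∀ ρ : ℕ → unitInterval, Tendsto (fun k => (ρ k : ℝ)) atTop (𝓝 0) →
      ∀ δ : ℝ, 0 < δ →
      ∃ k₀ : ℕ, 1 ≤ k₀ ∧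
        ∀ a : ℝ, 0 < a →
        ∀ (n : ℕ) (Ω : Type*) [MeasurableSpace Ω] (P : Measure Ω) [IsProbabilityMeasure P]
          (u : ℕ → Ω → UnitAddTorus (Fin d) → ℝ),
          (∀ k, 1 ≤ k → k ≤ n → ∀ ω, PhaseLabels.IsPhaseLabel (n - k) (u k ω)) →
          (∀ k, 1 ≤ k → k ≤ n → ∀ p, Measurable fun ω => u k ω p) →
          (∀ k, 1 ≤ k → k ≤ n → PhaseLabels.AssumptionA P (n - k) (ρ k) (u k)) →
          (∀ k, 1 ≤ k → k ≤ n →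
            ∀ᵐ ω ∂P, PhaseLabels.AssumptionB n (fun j => u j ω) k) →
          ∀ k, k₀ ≤ k → k ≤ n →
            P.real {ω | u k ω ∉ PhaseLabels.nbhd (PhaseLabels.perimeterBall d a) (2 * δ)} ≤
              Real.exp (-c₁ * ((2 : ℝ) ^ n) ^ (d - 1) *
                min (δ * (2 : ℝ) ^ ((n : ℤ) - d * k))
                  (min (a / (2 : ℝ) ^ ((d - 1) * k₀))
                    (δ * (2 : ℝ) ^ ((n : ℤ) - d * k₀) / (n : ℝ) ^ d))) := by
  have hd0 : (2 : ℝ) ≤ d := by exact_mod_cast hd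
  -- The factor `1 / (2 * d)` comes from the count of jumps, the factor `1 / 4` from the tail bound.
  refine ⟨1 / (8 * d), by positivity, fun ρ hρ δ hδ => ?_⟩
  rcases le_or_gt 1 δ with hδ1 | hδ1
  · refine ⟨1, le_rfl, fun a ha n Ω _ P _ u hlabel _ _ _ k hk hkn => ?_⟩
    have : {ω | u k ω ∉ PhaseLabels.nbhd (PhaseLabels.perimeterBall d a) (2 * δ)} = ∅ := by
      ext ω
      simp [PhaseLabels.mem_nbhd_of_one_le (hlabel k hk hkn ω) hδ1]
    rw [this, measureReal_empty]
    positivity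
  have hact : Tendsto (fun k => PhaseLabels.activity d (ρ k)) atTop (𝓝 0) := by
    have := (hρ.const_mul ((2 : ℝ) ^ 3 ^ d)).const_mul (Real.exp 1)
    rwa [mul_zero, mul_zero] at this
  have hfac : (1 : ℝ) ≤ d.factorial := by
    exact_mod_cast d.factorial_pos
  obtain ⟨κ', hκ'⟩ := eventually_atTop.1 (hact.eventually_le_const
    (show 0 < min (1 / (9 * 2 ^ d)) (δ / (36 * d.factorial)) by positivity))
  set κ := max κ' 1 with hκdef
  -- The reference scale `κ` must be strictly finer than `k`, so that its cells fit into `k`-boxes.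
  refine ⟨κ + 1, by omega, fun a ha n Ω _ P _ u hlabel hmeas hA hB k hk hkn => ?_⟩
  have hκ1 : 1 ≤ κ := le_max_right _ _
  have hκκ : κ' ≤ κ := le_max_left _ _
  have hxk : PhaseLabels.activity d (ρ k) ≤ δ / 9 := by
    refine (hκ' k (by omega)).trans ((min_le_right _ _).trans ?_)
    refine div_le_div_of_nonneg_left hδ.le (by norm_num) ?_
    linarith
  refine (PhaseLabels.measure_notMem_nbhd_le hd hκ1 (by omega) hkn (hlabel k (by omega) hkn)
    (hmeas k (by omega) hkn) (hmeas κ hκ1 (by omega)) (hA k (by omega) hkn)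
    (hA κ hκ1 (by omega)) (hB k (by omega) hkn) ha hδ hδ1 hxk (hκ' κ hκκ)).trans ?_
  set L : ℝ := min (δ * (2 : ℝ) ^ ((n : ℤ) - d * k))
    (min (a / (2 : ℝ) ^ ((d - 1) * (κ + 1)))
      (δ * (2 : ℝ) ^ ((n : ℤ) - d * (κ + 1 : ℕ)) / (n : ℝ) ^ d)) with hL
  set c : ℝ := 1 / (8 * d) with hc
  have hc0 : 0 < c := by positivity
  have hc16 : c ≤ 1 / 8 := one_div_le_one_div_of_le (by norm_num) (by linarith)
  have hN0 : (0 : ℝ) ≤ (2 ^ n) ^ (d - 1) := by positivity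
  have hκn : κ + 1 ≤ n := by omega
  have hpow : (2 : ℝ) ^ (n - (κ + 1)) ≤ 2 ^ (n - κ) :=
    pow_le_pow_right₀ (by norm_num) (by omega)
  have b1 : c * (2 ^ n) ^ (d - 1) * L ≤ δ * (2 ^ (n - k)) ^ d / 4 := by
    calc c * (2 ^ n) ^ (d - 1) * L ≤ c * (2 ^ n) ^ (d - 1) * (δ * (2 : ℝ) ^ ((n : ℤ) - d * k)) :=
          mul_le_mul_of_nonneg_left (min_le_left _ _) (by positivity)
      _ = c * (δ * (2 ^ (n - k)) ^ d) := by
          rw [← PhaseLabels.pow_mul_zpow_eq (by omega) hkn]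
          ring
      _ ≤ δ * (2 ^ (n - k)) ^ d / 4 := by
          have : 0 < δ * ((2 : ℝ) ^ (n - k)) ^ d := by positivity
          nlinarith
  have b2 : c * (2 ^ n) ^ (d - 1) * L ≤
      max 1 (a * (2 ^ (n - κ)) ^ (d - 1) / (2 * d)) / 4 := by
    have hle : (2 : ℝ) ^ n / 2 ^ (κ + 1) ≤ 2 ^ (n - κ) := by
      refine le_trans (le_of_eq ?_) hpow
      rw [pow_sub₀ _ two_ne_zero hκn, div_eq_mul_inv]
    calc c * (2 ^ n) ^ (d - 1) * L
        ≤ c * (2 ^ n) ^ (d - 1) * (a / (2 : ℝ) ^ ((d - 1) * (κ + 1))) :=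
          mul_le_mul_of_nonneg_left ((min_le_right _ _).trans (min_le_left _ _)) (by positivity)
      _ = c * (a * (2 ^ n / 2 ^ (κ + 1)) ^ (d - 1)) := by
          rw [div_pow, ← pow_mul 2 (κ + 1), mul_comm (κ + 1)]
          ring
      _ ≤ c * (a * (2 ^ (n - κ)) ^ (d - 1)) := by
          refine mul_le_mul_of_nonneg_left (mul_le_mul_of_nonneg_left ?_ ha.le) hc0.le
          exact pow_le_pow_left₀ (by positivity) hle _
      _ = a * (2 ^ (n - κ)) ^ (d - 1) / (2 * d) / 4 := by
          rw [hc]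
          field_simp
          norm_num
      _ ≤ _ := div_le_div_of_nonneg_right (le_max_right _ _) (by norm_num)
  have b3 : c * (2 ^ n) ^ (d - 1) * L ≤ δ / 2 * (2 ^ (n - κ)) ^ d / (n : ℝ) ^ d / 4 := by
    have hle : ((2 : ℝ) ^ (n - (κ + 1))) ^ d ≤ (2 ^ (n - κ)) ^ d :=
      pow_le_pow_left₀ (by positivity) hpow d
    calc c * (2 ^ n) ^ (d - 1) * L
        ≤ c * (2 ^ n) ^ (d - 1) *
            (δ * (2 : ℝ) ^ ((n : ℤ) - d * (κ + 1 : ℕ)) / (n : ℝ) ^ d) :=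
          mul_le_mul_of_nonneg_left ((min_le_right _ _).trans (min_le_right _ _)) (by positivity)
      _ = c * (δ * (2 ^ (n - (κ + 1))) ^ d / (n : ℝ) ^ d) := by
          rw [← PhaseLabels.pow_mul_zpow_eq (by omega) hκn]
          ring
      _ ≤ 1 / 8 * (δ * (2 ^ (n - κ)) ^ d / (n : ℝ) ^ d) := by
          refine mul_le_mul hc16 ?_ (by positivity) (by norm_num)
          exact div_le_div_of_nonneg_right (mul_le_mul_of_nonneg_left hle hδ.le) (by positivity)
      _ = _ := by ring
  have hexp : ∀ t : ℝ, c * (2 ^ n) ^ (d - 1) * L ≤ t →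
      Real.exp (-t) ≤ Real.exp (-c * (2 ^ n) ^ (d - 1) * L) := fun t ht =>
    Real.exp_le_exp.2 (by linarith)
  linarith [hexp _ b1, hexp _ b2, hexp _ b3]
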